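/- Let $d\ge 1$ and let $b:\mathbb{R}^d\to\mathbb{R}^d$ satisfy, for some constants $L_b,R,c,K>0$ and all $x,y\in\mathbb{R}^d$, $|b(x)-b(y)|\le L_b|x-y|$, together with $$\langle x-y,b(x)-b(y)\rangle\le\begin{cases}-c|x-y|^2 & \text{if } |x|\ge R\text{ or }|y|\ge R,\\ K|x-y|^2 & \text{otherwise.}\end{cases}$$ For $\delta,T>0$ let $Q=Q_{\delta,T}$ be the transition kernel of the Euler scheme $X_{k+1}=X_k+\delta b(X_k)+\sqrt{2T\delta}\,Z_{k+1}$, where $(Z_k)$ are i.i.d. standard Gaussian vectors in $\mathbb{R}^d$, and let $\mathcal{W}_2$ be the $L^2$-Wasserstein distance for the Euclidean distance, $\mathcal{W}_2(\mu,\nu)=\big(\inf_{\pi}\int|x-y|^2\,d\pi(x,y)\big)^{1/2}\in[0,\infty]$, the infimum being over all couplings $\pi$ of $\mu$ and $\nu$. A probability measure $\mu$ on $\mathbb{R}^d$ satisfies the Poincaré inequality with constant $C$ if every $f\in\mathcal{C}^\infty(\mathbb{R}^d)$ with polynomial growth is in $L^2(\mu)$ and $$\int f^2\,d\mu-\Big(\int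 f\,d\mu\Big)^2\le C\int|\nabla f|^2\,d\mu$$ (the right-hand side possibly being $+\infty$); a Markov kernel $\bar Q$ satisfies the local Poincaré inequality with constant $C$ if $\bar Q(x,\cdot)$ satisfies the Poincaré inequality with constant $C$ for every $x\in\mathbb{R}^d$. Then there exist constants $h,\delta_0,T_0>0$ and $M\ge1$ such that $$\mathcal{W}_2(\mu Q^k,\nu Q^k)\le M(1-h\delta)^k\,\mathcal{W}_2(\mu,\nu)\qquad\text{for all }\delta\in(0,\delta_0],\ T\ge T_0,\ k\ge1\text{ and all probability measures }\mu,\nu\text{ on }\mathbb{R}^d. \tag{$*$}$$ Moreover, for any constants $h,\delta_0,T_0>0$ and $M\ge1$ satisfying $(*)$, and for all $\delta\in(0,\delta_0)$ and $T\ge T_0$: 1. for every $k\ge1$, $Q^k$ satisfies the local Poincaré inequality with constant $\frac{2TM^2}{2h-h^2\delta}$; 2. $Q$ has a unique invariant probability measure $\pi_\infty$, and $\pi_\infty$ satisfies the Poincaré inequality with the same constant $\frac{2TM^2}{2h-h^2\delta}$; 3. this constant is bounded uniformly in the step size: $0<\frac{2TM^2}{2h-h^2\delta}\le\frac{2TM^2}{h}$.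 -/

import Mathlib

open MeasureTheory ProbabilityTheory
open scoped ENNReal ContDiff

/-- The `L²`-Wasserstein distance: the square root of the infimum of `∫ |x - y|² dπ` over all
couplings `π` of `μ` and `ν` (possibly infinite). -/
noncomputable def wasserstein2 {E : Type*} [PseudoEMetricSpace E] [MeasurableSpace E]
    (μ ν : Measure E) : ℝ≥0∞ :=
  (⨅ π ∈ {π : Measure (E × E) | π.fst = μ ∧ π.snd = ν},
    ∫⁻ z, edist z.1 z.2 ^ 2 ∂π) ^ (1 / 2 : ℝ)

/-- Transition kernel of the Euler scheme `X' = X + δ b(X) + √(2Tδ) Z` with `Z` a standard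
Gaussian vector independent of `X`. -/
noncomputable def eulerKernel {d : ℕ} (b : EuclideanSpace ℝ (Fin d) → EuclideanSpace ℝ (Fin d))
    (δ T : ℝ) : Kernel (EuclideanSpace ℝ (Fin d)) (EuclideanSpace ℝ (Fin d)) :=
  (Kernel.id ×ₖ Kernel.const _ (stdGaussian (EuclideanSpace ℝ (Fin d)))).map
    (fun p => p.1 + δ • b p.1 + Real.sqrt (2 * T * δ) • p.2)

/-- For measurable `b`, `Q(x, ·)` is the law of `x + δ b(x) + √(2Tδ) Z`. -/
theorem eulerKernel_apply {d : ℕ}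
    {b : EuclideanSpace ℝ (Fin d) → EuclideanSpace ℝ (Fin d)} (hb : Measurable b) (δ T : ℝ)
    (x : EuclideanSpace ℝ (Fin d)) :
    eulerKernel b δ T x = (stdGaussian (EuclideanSpace ℝ (Fin d))).map
      (fun z => x + δ • b x + Real.sqrt (2 * T * δ) • z) := by
  have hm : Measurable (fun p : EuclideanSpace ℝ (Fin d) × EuclideanSpace ℝ (Fin d) =>
      p.1 + δ • b p.1 + Real.sqrt (2 * T * δ) • p.2) := by fun_prop
  rw [eulerKernel, Kernel.map_apply _ hm, Kernel.prod_apply, Kernel.id_apply,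
    Kernel.const_apply, Measure.dirac_prod, Measure.map_map hm (by fun_prop)]
  rfl

/-- `μ` satisfies the Poincaré inequality with constant `C`: for every smooth `f` of polynomial
growth, `f` and `f²` are `μ`-integrable and `μ(f²) - (μ f)² ≤ C μ(|∇f|²)`, where the right-hand
side may be infinite (only `f`, not its gradient, is required to have polynomial growth). -/
def PoincareInequality {d : ℕ} (μ : Measure (EuclideanSpace ℝ (Fin d))) (C : ℝ) : Prop :=
  ∀ f : EuclideanSpace ℝ (Fin d) → ℝ, ContDiff ℝ ∞ f →
    (∃ (A : ℝ) (m : ℕ), ∀ x, |f x| ≤ A * (1 + ‖x‖) ^ m) →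
    Integrable f μ ∧ Integrable (fun x => f x ^ 2) μ ∧
      ENNReal.ofReal (∫ x, f x ^ 2 ∂μ - (∫ x, f x ∂μ) ^ 2) ≤
        ENNReal.ofReal C * ∫⁻ x, ENNReal.ofReal (‖gradient f x‖ ^ 2) ∂μ

/-- The kernel `Q` satisfies the local Poincaré inequality with constant `C`. -/
def LocalPoincareInequality {d : ℕ}
    (Q : Kernel (EuclideanSpace ℝ (Fin d)) (EuclideanSpace ℝ (Fin d))) (C : ℝ) : Prop :=
  ∀ x, PoincareInequality (Q x) C

/-- The constants `h, δ₀, T₀ > 0` and `M ≥ 1` are such that for all `δ ∈ (0, δ₀]`, all `T ≥ T₀`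
and all `k ≥ 1`, the kernel `Q` of the Euler scheme satisfies
`W₂(μ Q^k, ν Q^k) ≤ M (1 - h δ)^k W₂(μ, ν)` for all probability measures `μ, ν`. -/
def EulerW2Contraction {d : ℕ} (b : EuclideanSpace ℝ (Fin d) → EuclideanSpace ℝ (Fin d))
    (h δ₀ T₀ M : ℝ) : Prop :=
  0 < h ∧ 0 < δ₀ ∧ 0 < T₀ ∧ 1 ≤ M ∧
    ∀ δ T : ℝ, 0 < δ → δ ≤ δ₀ → T₀ ≤ T → ∀ k : ℕ, 1 ≤ k →
      ∀ μ ν : Measure (EuclideanSpace ℝ (Fin d)),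
        IsProbabilityMeasure μ → IsProbabilityMeasure ν →
        wasserstein2
            (μ.bind (eulerKernel b δ T ^ k :
              Kernel (EuclideanSpace ℝ (Fin d)) (EuclideanSpace ℝ (Fin d))))
            (ν.bind (eulerKernel b δ T ^ k :
              Kernel (EuclideanSpace ℝ (Fin d)) (EuclideanSpace ℝ (Fin d)))) ≤
          ENNReal.ofReal (M * (1 - h * δ) ^ k) * wasserstein2 μ ν

/-! ### Cauchy–Schwarz for lower integrals -/

/-! Contraction. Two copies of the chain driven by the same noise differ after one step by a
deterministic amount, so `|x - y|²` is multiplied by at most `1 - 2cδ + Lb²δ²` when one copy is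
outside the ball of radius `R`, and by at most `1 + 2Kδ + Lb²δ²` otherwise. At high temperature the
chain spends little time in that ball. The expansion is therefore absorbed in a bounded weight:
`w(x)|x - y|²` contracts in mean, where `w - 1` is proportional to the expected time spent in the
ball over a fixed physical time (`exists_eulerW2Contraction`). Escape from the ball is measured with
the test functions `exp(-l|y|²)`, whose Gaussian integrals are explicit.

Local Poincaré. With `ρ = 1 - hδ`, the variance splits as `Var_{Q^{k+1}} f = Q(Var_{Q^k} f) +
Var_Q(Q^k f)`. The Wasserstein contraction between Dirac masses dualizes to the gradient bound
`|∇Q^k f| ≤ M ρ^k (Q^k |∇f|²)^{1/2}`, and `Q` is Gaussian with Poincaré constant `2Tδ`. Summing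
gives `2TδM² ∑ ρ^{2i} ≤ 2TδM²/(1 - ρ²)`, the announced constant
(`DiracContraction.variance_pow_le`). Since `Q^k f` is only known to be Lipschitz, gradients are
replaced by local slopes with a quadratic error, and the Gaussian inequality is proved in that form
(`stdGaussian_poincare`).

Invariant measure. The laws `Q^k(0, ·)` are tight, and their integrals against bounded Lipschitz
functions are Cauchy, so they converge weakly. The Poincaré inequality passes to the limit on
compactly supported functions and is extended by cutoffs; the moments this needs come from the
Poincaré inequality itself.

That `hδ < 1` is not assumed: a rate that reached zero before `δ₀` would force `x + s b(x)` to be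
constant in `x` for two different step sizes `s`. -/

theorem sq_lintegral_mul_le {α : Type*} [MeasurableSpace α] (μ : Measure α) {f g : α → ℝ≥0∞}
    (hf : AEMeasurable f μ) (hg : AEMeasurable g μ) :
    (∫⁻ a, f a * g a ∂μ) ^ 2 ≤ (∫⁻ a, f a ^ 2 ∂μ) * ∫⁻ a, g a ^ 2 ∂μ := by
  have h := ENNReal.lintegral_mul_le_Lp_mul_Lq μ Real.HolderConjugate.two_two hf hg
  simp only [Pi.mul_apply, ENNReal.rpow_ofNat] at h
  calc (∫⁻ a, f a * g a ∂μ) ^ 2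
      ≤ ((∫⁻ a, f a ^ 2 ∂μ) ^ (1 / 2 : ℝ) * (∫⁻ a, g a ^ 2 ∂μ) ^ (1 / 2 : ℝ)) ^ 2 := by gcongr
    _ = _ := by
      rw [mul_pow, ← ENNReal.rpow_natCast, ← ENNReal.rpow_natCast, ← ENNReal.rpow_mul,
        ← ENNReal.rpow_mul]
      norm_num

theorem sq_lintegral_le {α : Type*} [MeasurableSpace α] (μ : Measure α) {f : α → ℝ≥0∞}
    (hf : AEMeasurable f μ) :
    (∫⁻ a, f a ∂μ) ^ 2 ≤ μ Set.univ * ∫⁻ a, f a ^ 2 ∂μ := by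
  simpa [mul_comm] using sq_lintegral_mul_le μ hf (aemeasurable_const (b := (1 : ℝ≥0∞)))

/-! ### The one-dimensional Gaussian Poincaré inequality -/

/-- The standard Gaussian density `φ` satisfies `φ' = -xφ`, so `-φ` is a primitive of the integrand
and vanishes at infinity. -/
theorem setIntegral_Ici_id_gaussianReal (s : ℝ) :
    ∫ y in Set.Ici s, y ∂(gaussianReal 0 1) = gaussianPDFReal 0 1 s := by
  have hder : ∀ x : ℝ, HasDerivAt (fun x => - gaussianPDFReal 0 1 x)
      (gaussianPDFReal 0 1 x * x) x := by
    intro x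
    have h1 : HasDerivAt (fun x : ℝ => -(x - 0) ^ 2 / (2 * (1 : NNReal))) (-x) x := by
      have := ((hasDerivAt_id x).sub_const 0).pow 2 |>.neg |>.div_const (2 * (1 : ℝ))
      simp only [NNReal.coe_one]
      refine this.congr_deriv ?_
      simp
      ring
    have h2 := ((h1.exp).const_mul ((√(2 * Real.pi * (1 : NNReal)))⁻¹)).neg
    rw [gaussianPDFReal_def]
    refine h2.congr_deriv ?_
    simp only
    ring
  have hint : Integrable (fun x => gaussianPDFReal 0 1 x * x) := by
    have h := (IsGaussian.memLp_id (gaussianReal 0 1) 1 (by simp)).integrable le_rfl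
    rw [gaussianReal_of_var_ne_zero 0 one_ne_zero] at h
    have h' := (integrable_withDensity_iff_integrable_smul₀' (μ := volume)
      (measurable_gaussianPDF 0 1).aemeasurable (by simp [gaussianPDF])).1 h
    refine h'.congr (ae_of_all _ fun x => ?_)
    simp [gaussianPDF, gaussianPDFReal_nonneg]
  have hlim : Filter.Tendsto (fun x => - gaussianPDFReal 0 1 x) Filter.atTop (nhds 0) := by
    rw [gaussianPDFReal_def]
    have : Filter.Tendsto (fun x : ℝ => -(x - 0) ^ 2 / (2 * (1 : NNReal)))
        Filter.atTop Filter.atBot := by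
      have h1 : Filter.Tendsto (fun x : ℝ => x ^ 2 / 2) Filter.atTop Filter.atTop :=
        (Filter.tendsto_pow_atTop (by norm_num)).atTop_div_const (by norm_num)
      refine (Filter.tendsto_neg_atTop_atBot.comp h1).congr fun x => ?_
      simp [neg_div]
    simpa using ((Real.tendsto_exp_atBot.comp this).const_mul
      ((√(2 * Real.pi * (1 : NNReal)))⁻¹)).neg
  have key := integral_Ioi_of_hasDerivAt_of_tendsto (a := s)
    (hder s).continuousAt.continuousWithinAt (fun x _ => hder x) hint.integrableOn hlim
  rw [gaussianReal_of_var_ne_zero 0 one_ne_zero,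
    restrict_withDensity measurableSet_Ici]
  rw [integral_withDensity_eq_integral_toReal_smul (measurable_gaussianPDF 0 1)
    (by simp [gaussianPDF])]
  rw [integral_Ici_eq_integral_Ioi]
  simpa [gaussianPDF, gaussianPDFReal_nonneg] using key

/-- Writing `y - x = (y - s) + (s - x)` separates the variables; the two terms in `s P(X < s) P(Y ≥
s)` cancel and `φ(s)` remains. This identity gives the one-dimensional Poincaré inequality its
constant `1`. -/
theorem lintegral_gaussianReal_straddle (s : ℝ) :
    ∫⁻ x, ∫⁻ y, (if x < s ∧ s ≤ y then ENNReal.ofReal (y - x) else 0)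
      ∂(gaussianReal 0 1) ∂(gaussianReal 0 1) = gaussianPDF 0 1 s := by
  set γ := gaussianReal 0 1 with hγ
  have hid : Integrable (fun x : ℝ => x) γ :=
    (IsGaussian.memLp_id γ 1 (by simp)).integrable le_rfl
  have hI := setIntegral_Ici_id_gaussianReal s
  rw [← hγ] at hI
  have hsum := integral_add_compl (measurableSet_Ici (a := s)) hid
  rw [Set.compl_Ici, hI] at hsum
  have h0 : ∫ x, x ∂γ = 0 := integral_id_gaussianReal
  have hA : ∫⁻ y in Set.Ici s, ENNReal.ofReal (y - s) ∂γ
      = ENNReal.ofReal (gaussianPDFReal 0 1 s - s * γ.real (Set.Ici s)) := by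
    rw [← ofReal_integral_eq_lintegral_ofReal]
    · rw [integral_sub hid.integrableOn (integrable_const _), hI]
      simp [mul_comm]
    · exact (hid.sub (integrable_const s)).integrableOn
    · filter_upwards [ae_restrict_mem measurableSet_Ici] with y hy
      simpa using hy
  have hB : ∫⁻ x in Set.Iio s, ENNReal.ofReal (s - x) ∂γ
      = ENNReal.ofReal (s * γ.real (Set.Iio s) + gaussianPDFReal 0 1 s) := by
    rw [← ofReal_integral_eq_lintegral_ofReal]
    · rw [integral_sub (integrable_const _) hid.integrableOn]
      congr 1
      simp only [integral_const, measureReal_restrict_apply, MeasurableSet.univ, Set.univ_inter,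
        smul_eq_mul]
      linarith
    · exact ((integrable_const s).sub hid).integrableOn
    · filter_upwards [ae_restrict_mem measurableSet_Iio] with y hy
      simpa using (Set.mem_Iio.1 hy).le
  have hA0 : 0 ≤ gaussianPDFReal 0 1 s - s * γ.real (Set.Ici s) := by
    have : 0 ≤ ∫ y in Set.Ici s, (y - s) ∂γ :=
      setIntegral_nonneg measurableSet_Ici fun y hy => by simpa using hy
    rw [integral_sub hid.integrableOn (integrable_const _), hI] at this
    simpa [mul_comm] using this
  have hB0 : 0 ≤ s * γ.real (Set.Iio s) + gaussianPDFReal 0 1 s := by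
    have : 0 ≤ ∫ y in Set.Iio s, (s - y) ∂γ :=
      setIntegral_nonneg measurableSet_Iio fun y hy => by simpa using (Set.mem_Iio.1 hy).le
    rw [integral_sub (integrable_const _) hid.integrableOn] at this
    simp only [integral_const, measureReal_restrict_apply, MeasurableSet.univ, Set.univ_inter,
      smul_eq_mul] at this
    linarith
  have hpt : ∀ x y : ℝ, (if x < s ∧ s ≤ y then ENNReal.ofReal (y - x) else 0)
      = (Set.Iio s).indicator (fun _ => (Set.Ici s).indicator
          (fun y => ENNReal.ofReal (y - s)) y) x +
        (Set.Iio s).indicator (fun x => (Set.Ici s).indicator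
          (fun _ => ENNReal.ofReal (s - x)) y) x := by
    intro x y
    by_cases hx : x < s <;> by_cases hy : s ≤ y <;> simp [hx, hy, Set.indicator]
    rw [← ENNReal.ofReal_add (by linarith) (by linarith)]
    congr 1; ring
  have hprob : γ.real (Set.Ici s) + γ.real (Set.Iio s) = 1 := by
    rw [← Set.compl_Ici]; exact probReal_add_probReal_compl measurableSet_Ici
  have hin : ∀ x, ∫⁻ y, (if x < s ∧ s ≤ y then ENNReal.ofReal (y - x) else 0) ∂γ
      = (Set.Iio s).indicator (fun x =>
          ENNReal.ofReal (gaussianPDFReal 0 1 s - s * γ.real (Set.Ici s))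
          + ENNReal.ofReal (s - x) * γ (Set.Ici s)) x := by
    intro x
    by_cases hx : x < s
    · simp_rw [hpt]
      simp only [Set.mem_Iio, hx, Set.indicator_of_mem]
      rw [lintegral_add_left ((by fun_prop : Measurable fun y : ℝ =>
        ENNReal.ofReal (y - s)).indicator measurableSet_Ici),
        lintegral_indicator measurableSet_Ici, lintegral_indicator measurableSet_Ici, hA]
      simp
    · simp [hx]
  simp_rw [hin]
  rw [lintegral_indicator measurableSet_Iio, lintegral_add_left measurable_const,
    lintegral_mul_const _ (by fun_prop), hB]
  simp only [lintegral_const, MeasurableSet.univ, Measure.restrict_apply, Set.univ_inter]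
  rw [← ofReal_measureReal (μ := γ) (s := Set.Ici s),
    ← ofReal_measureReal (μ := γ) (s := Set.Iio s),
    ← ENNReal.ofReal_mul hA0, ← ENNReal.ofReal_mul hB0,
    ← ENNReal.ofReal_add (by positivity) (by positivity), gaussianPDF]
  congr 1
  linear_combination (gaussianPDFReal 0 1 s) * hprob

/-- The form over independent pairs allows pointwise estimates of `f x - f y`, and Tonelli without
integrability conditions. -/
theorem variance_eq_lintegral_sq_sub {α : Type*} [MeasurableSpace α] (μ : Measure α)
    [IsProbabilityMeasure μ] {f : α → ℝ} (hf : Integrable f μ)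
    (hf2 : Integrable (fun x => f x ^ 2) μ) :
    2 * ENNReal.ofReal (∫ x, f x ^ 2 ∂μ - (∫ x, f x ∂μ) ^ 2)
      = ∫⁻ x, ∫⁻ y, ENNReal.ofReal ((f x - f y) ^ 2) ∂μ ∂μ := by
  have hy : ∀ x, Integrable (fun y => (f x - f y) ^ 2) μ := fun x => by
    have := ((integrable_const (f x ^ 2)).sub (hf.const_mul (2 * f x))).add hf2
    refine this.congr (ae_of_all _ fun y => ?_)
    simp only [Pi.add_apply, Pi.sub_apply]; ring
  have hyv : ∀ x, ∫ y, (f x - f y) ^ 2 ∂μ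
      = f x ^ 2 - 2 * f x * (∫ y, f y ∂μ) + ∫ y, f y ^ 2 ∂μ := fun x => by
    have : ∀ y, (f x - f y) ^ 2 = (f x ^ 2 - 2 * f x * f y) + f y ^ 2 := fun y => by ring
    simp_rw [this]
    rw [integral_add (f := fun y => f x ^ 2 - 2 * f x * f y)
      ((integrable_const _).sub (hf.const_mul _)) hf2,
      integral_sub (integrable_const _) (hf.const_mul _), integral_const_mul]
    simp
  have hin : ∀ x, ∫⁻ y, ENNReal.ofReal ((f x - f y) ^ 2) ∂μ
      = ENNReal.ofReal (f x ^ 2 - 2 * f x * (∫ y, f y ∂μ) + ∫ y, f y ^ 2 ∂μ) := fun x => by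
    rw [← ofReal_integral_eq_lintegral_ofReal (hy x) (ae_of_all _ fun y => sq_nonneg _), hyv]
  simp_rw [hin]
  rw [← ofReal_integral_eq_lintegral_ofReal]
  · rw [integral_add (f := fun x => f x ^ 2 - 2 * f x * ∫ y, f y ∂μ)
        (hf2.sub ((hf.const_mul 2).mul_const _)) (integrable_const _),
      integral_sub hf2 ((hf.const_mul 2).mul_const _), integral_mul_const, integral_const_mul]
    rw [show (2 : ℝ≥0∞) = ENNReal.ofReal 2 by simp, ← ENNReal.ofReal_mul (by norm_num)]
    congr 1
    simp only [integral_const, probReal_univ, one_smul]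
    ring
  · exact (hf2.sub ((hf.const_mul 2).mul_const _)).add (integrable_const _)
  · refine ae_of_all _ fun x => ?_
    simp only [Pi.zero_apply]
    rw [← hyv]
    exact integral_nonneg fun y => sq_nonneg _

/-- Poincaré inequality for the standard Gaussian on `ℝ`, with an upper gradient `G`. -/
theorem gaussianReal_poincare {f : ℝ → ℝ} (hf : Integrable f (gaussianReal 0 1))
    (hf2 : Integrable (fun x => f x ^ 2) (gaussianReal 0 1)) {G : ℝ → ℝ≥0∞} (hG : Measurable G)
    (hfG : ∀ s t, s < t → ENNReal.ofReal |f t - f s| ≤ ∫⁻ u in Set.Ioc s t, G u) :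
    ENNReal.ofReal (∫ x, f x ^ 2 ∂(gaussianReal 0 1) - (∫ x, f x ∂(gaussianReal 0 1)) ^ 2)
      ≤ ∫⁻ u, G u ^ 2 ∂(gaussianReal 0 1) := by
  set γ := gaussianReal 0 1 with hγ
  -- Cauchy–Schwarz on `(x, y]` bounds `(f x - f y)²` by `(y - x) ∫ G²` over that interval; `k`
  -- carries the factor and the interval, and vanishes unless `x < y`.
  let k : ℝ → ℝ → ℝ → ℝ≥0∞ := fun x y u => if x < u ∧ u ≤ y then ENNReal.ofReal (y - x) else 0
  have hkm : Measurable (fun p : ℝ × ℝ × ℝ => k p.1 p.2.1 p.2.2) := by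
    refine Measurable.ite ?_ (by fun_prop) measurable_const
    exact (measurableSet_lt measurable_fst (measurable_snd.comp measurable_snd)).inter
      (measurableSet_le (measurable_snd.comp measurable_snd) (measurable_fst.comp measurable_snd))
  let J : ℝ → ℝ → ℝ≥0∞ := fun x y => ∫⁻ u, k x y u * G u ^ 2
  have hlt : ∀ x y, x < y → ENNReal.ofReal ((f x - f y) ^ 2) ≤ J x y := by
    intro x y hxy
    calc ENNReal.ofReal ((f x - f y) ^ 2) = ENNReal.ofReal |f y - f x| ^ 2 := by
          rw [← ENNReal.ofReal_pow (abs_nonneg _), sq_abs]; congr 1; ring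
      _ ≤ (∫⁻ u in Set.Ioc x y, G u) ^ 2 := by gcongr; exact hfG x y hxy
      _ ≤ ENNReal.ofReal (y - x) * ∫⁻ u in Set.Ioc x y, G u ^ 2 := by
          simpa using sq_lintegral_le (volume.restrict (Set.Ioc x y)) hG.aemeasurable
      _ = J x y := by
          rw [← lintegral_const_mul _ (by fun_prop), ← lintegral_indicator measurableSet_Ioc]
          refine lintegral_congr fun u => ?_
          by_cases hu : x < u ∧ u ≤ y <;> simp [k, Set.indicator, hu]
  have hpt : ∀ x y, ENNReal.ofReal ((f x - f y) ^ 2)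
      ≤ J x y + J y x := by
    intro x y
    rcases lt_trichotomy x y with h | h | h
    · exact (hlt x y h).trans le_self_add
    · simp [h]
    · refine le_trans ?_ le_add_self
      rw [show (f x - f y) ^ 2 = (f y - f x) ^ 2 by ring]
      exact hlt y x h
  have hmI : Measurable (fun p : ℝ × ℝ => J p.1 p.2) := by
    refine Measurable.lintegral_prod_right'
      (f := fun q : (ℝ × ℝ) × ℝ => k q.1.1 q.1.2 q.2 * G q.2 ^ 2) ?_
    refine Measurable.mul ?_ (by fun_prop)
    exact hkm.comp (by fun_prop : Measurable fun q : (ℝ × ℝ) × ℝ => (q.1.1, q.1.2, q.2))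
  -- After Tonelli, the integral of `k` over `x` and `y` is the Gaussian density at `u`, which turns
  -- `du` into the Gaussian measure.
  have hI : ∫⁻ x, ∫⁻ y, J x y ∂γ ∂γ = ∫⁻ u, G u ^ 2 ∂γ := by
    have h1 : ∀ x, ∫⁻ y, J x y ∂γ = ∫⁻ u, (∫⁻ y, k x y u ∂γ) * G u ^ 2 := by
      intro x
      simp only [J]
      rw [lintegral_lintegral_swap]
      · refine lintegral_congr fun u => ?_
        rw [lintegral_mul_const]
        exact hkm.comp (by fun_prop : Measurable fun y : ℝ => (x, y, u))
      · refine Measurable.aemeasurable ?_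
        refine Measurable.mul ?_ (by fun_prop)
        exact hkm.comp (by fun_prop : Measurable fun q : ℝ × ℝ => (x, q.1, q.2))
    simp_rw [h1]
    have hm2 : Measurable (fun p : ℝ × ℝ => ∫⁻ y, k p.1 y p.2 ∂γ) := by
      refine Measurable.lintegral_prod_right' (f := fun q : (ℝ × ℝ) × ℝ => k q.1.1 q.2 q.1.2) ?_
      exact hkm.comp (by fun_prop : Measurable fun q : (ℝ × ℝ) × ℝ => (q.1.1, q.2, q.1.2))
    rw [lintegral_lintegral_swap]
    · have : ∀ u, ∫⁻ x, (∫⁻ y, k x y u ∂γ) * G u ^ 2 ∂γ = gaussianPDF 0 1 u * G u ^ 2 := by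
        intro u
        rw [lintegral_mul_const]
        · rw [← lintegral_gaussianReal_straddle u]
        · exact hm2.comp (by fun_prop : Measurable fun x : ℝ => (x, u))
      simp_rw [this]
      rw [hγ, gaussianReal_of_var_ne_zero 0 one_ne_zero,
        lintegral_withDensity_eq_lintegral_mul _ (measurable_gaussianPDF 0 1) (by fun_prop)]
      rfl
    · exact (hm2.mul (by fun_prop)).aemeasurable
  have hmain : 2 * ENNReal.ofReal (∫ x, f x ^ 2 ∂γ - (∫ x, f x ∂γ) ^ 2)
      ≤ 2 * ∫⁻ u, G u ^ 2 ∂γ := by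
    rw [variance_eq_lintegral_sq_sub γ hf hf2]
    calc ∫⁻ x, ∫⁻ y, ENNReal.ofReal ((f x - f y) ^ 2) ∂γ ∂γ
        ≤ ∫⁻ x, ∫⁻ y, (J x y + J y x) ∂γ ∂γ :=
          lintegral_mono fun x => lintegral_mono fun y => hpt x y
      _ = ∫⁻ x, ((∫⁻ y, J x y ∂γ) + ∫⁻ y, J y x ∂γ) ∂γ := by
          refine lintegral_congr fun x => lintegral_add_left ?_ _
          exact hmI.comp (by fun_prop : Measurable fun y : ℝ => (x, y))
      _ = (∫⁻ x, ∫⁻ y, J x y ∂γ ∂γ)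
            + ∫⁻ x, ∫⁻ y, J y x ∂γ ∂γ :=
          lintegral_add_left hmI.lintegral_prod_right' _
      _ = 2 * ∫⁻ u, G u ^ 2 ∂γ := by
          rw [lintegral_lintegral_swap (f := fun x y => J y x), hI, two_mul]
          exact (hmI.comp measurable_swap).aemeasurable
  exact (ENNReal.mul_le_mul_iff_right (by norm_num) (by norm_num)).1 hmain

/-! ### Tensorization -/

/-- No integrability is needed, because the Bochner integral of a non-integrable function is `0` by
default. -/
theorem ofReal_integral_le_lintegral {α : Type*} [MeasurableSpace α] {μ : Measure α} (f : α → ℝ) :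
    ENNReal.ofReal (∫ x, f x ∂μ) ≤ ∫⁻ x, ENNReal.ofReal (f x) ∂μ := by
  by_cases hf : Integrable f μ
  · calc ENNReal.ofReal (∫ x, f x ∂μ) ≤ ENNReal.ofReal (∫ x, max (f x) 0 ∂μ) :=
          ENNReal.ofReal_le_ofReal (integral_mono hf hf.pos_part fun x => le_max_left _ _)
      _ = ∫⁻ x, ENNReal.ofReal (max (f x) 0) ∂μ :=
          ofReal_integral_eq_lintegral_ofReal hf.pos_part (ae_of_all _ fun x => le_max_right _ _)
      _ = ∫⁻ x, ENNReal.ofReal (f x) ∂μ := by simp [ENNReal.ofReal_max]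
  · simp [integral_undef hf]

theorem integrable_of_abs_le {α : Type*} [MeasurableSpace α] {μ : Measure α} [IsFiniteMeasure μ]
    {f : α → ℝ} (hf : Measurable f) {B : ℝ} (hB : ∀ x, |f x| ≤ B) : Integrable f μ :=
  Integrable.of_bound hf.aestronglyMeasurable B (ae_of_all _ hB)

theorem integrable_sq_of_abs_le {α : Type*} [MeasurableSpace α] {μ : Measure α}
    [IsFiniteMeasure μ] {f : α → ℝ} (hf : Measurable f) {B : ℝ} (hB : ∀ x, |f x| ≤ B) :
    Integrable (fun x => f x ^ 2) μ :=
  integrable_of_abs_le (hf.pow_const 2) (B := B ^ 2) fun x => by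
    rw [abs_pow]; exact pow_le_pow_left₀ (abs_nonneg _) (hB x) 2

theorem abs_integral_le_of_abs_le {α : Type*} [MeasurableSpace α] {μ : Measure α}
    [IsProbabilityMeasure μ] {f : α → ℝ} {B : ℝ} (hB : ∀ x, |f x| ≤ B) : |∫ x, f x ∂μ| ≤ B := by
  simpa using norm_integral_le_of_norm_le_const (μ := μ) (f := f) (C := B) (ae_of_all _ hB)

/-- Poincaré inequality for the standard Gaussian on `ℝⁿ`, with upper gradients along the
coordinate axes. -/
theorem pi_gaussianReal_poincare (n : ℕ) {f : (Fin n → ℝ) → ℝ} (hf : Measurable f) {B : ℝ}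
    (hB : ∀ x, |f x| ≤ B) {G : Fin n → (Fin n → ℝ) → ℝ≥0∞} (hG : ∀ i, Measurable (G i))
    (hfG : ∀ i x s t, s < t → ENNReal.ofReal
      |f (Function.update x i t) - f (Function.update x i s)|
        ≤ ∫⁻ u in Set.Ioc s t, G i (Function.update x i u)) :
    ENNReal.ofReal (∫ x, f x ^ 2 ∂(Measure.pi fun _ => gaussianReal 0 1)
        - (∫ x, f x ∂(Measure.pi fun _ => gaussianReal 0 1)) ^ 2)
      ≤ ∑ i, ∫⁻ x, G i x ^ 2 ∂(Measure.pi fun _ => gaussianReal 0 1) := by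
  induction n with
  | zero =>
    rw [Measure.pi_of_empty (fun _ : Fin 0 => gaussianReal 0 1)]
    simp
  | succ n ih =>
    set γ := gaussianReal 0 1 with hγ
    set ν : Measure (Fin n → ℝ) := Measure.pi fun _ => γ with hν
    have hmp := measurePreserving_piFinSuccAbove (α := fun _ : Fin (n + 1) => ℝ)
      (fun _ => γ) 0
    have hcons : Measurable (fun p : ℝ × (Fin n → ℝ) => (Fin.cons p.1 p.2 : Fin (n + 1) → ℝ)) := by
      have := (MeasurableEquiv.piFinSuccAbove (fun _ : Fin (n + 1) => ℝ) 0).symm.measurable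
      convert this using 2
      simp only [MeasurableEquiv.piFinSuccAbove, Fin.insertNthEquiv_zero]
      rfl
    have hmap : (γ.prod ν).map (fun p : ℝ × (Fin n → ℝ) => (Fin.cons p.1 p.2 : Fin (n + 1) → ℝ))
        = Measure.pi fun _ : Fin (n + 1) => γ := by
      have := hmp.symm.map_eq
      convert this using 2
      ext p : 1
      simp only [MeasurableEquiv.piFinSuccAbove, Fin.insertNthEquiv_zero]
      rfl
    have hint : ∀ {F : (Fin (n + 1) → ℝ) → ℝ}, Measurable F → ∀ {C : ℝ}, (∀ x, |F x| ≤ C) →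
        ∫ x, F x ∂(Measure.pi fun _ : Fin (n + 1) => γ) = ∫ t, ∫ y, F (Fin.cons t y) ∂ν ∂γ := by
      intro F hF C hC
      rw [← hmap, integral_map hcons.aemeasurable hF.aestronglyMeasurable]
      exact integral_prod _ (integrable_of_abs_le (hF.comp hcons) fun _ => hC _)
    have hlint : ∀ {F : (Fin (n + 1) → ℝ) → ℝ≥0∞}, Measurable F →
        ∫⁻ x, F x ∂(Measure.pi fun _ : Fin (n + 1) => γ) = ∫⁻ t, ∫⁻ y, F (Fin.cons t y) ∂ν ∂γ := by
      intro F hF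
      rw [← hmap, lintegral_map hF hcons]
      exact lintegral_prod _ (hF.comp hcons).aemeasurable
    have hB2 : ∀ x, |f x ^ 2| ≤ B ^ 2 := fun x => by
      rw [abs_pow]; exact pow_le_pow_left₀ (abs_nonneg _) (hB x) 2
    have hct : ∀ t, Measurable (fun y : Fin n → ℝ => (Fin.cons t y : Fin (n + 1) → ℝ)) :=
      fun t => hcons.comp measurable_prodMk_left
    -- The variance is the mean of the variance at fixed first coordinate, bounded by induction,
    -- plus the variance of the conditional mean `h`, bounded in dimension one.
    set h : ℝ → ℝ := fun t => ∫ y, f (Fin.cons t y) ∂ν with hh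
    have hhm : Measurable h :=
      ((hf.comp hcons).stronglyMeasurable.integral_prod_right'
        (f := fun p => f (Fin.cons p.1 p.2))).measurable
    have hhB : ∀ t, |h t| ≤ B := fun t => abs_integral_le_of_abs_le fun _ => hB _
    have hsm : Measurable (fun t => ∫ y, f (Fin.cons t y) ^ 2 ∂ν) :=
      (((hf.pow_const 2).comp hcons).stronglyMeasurable.integral_prod_right'
        (f := fun p => f (Fin.cons p.1 p.2) ^ 2)).measurable
    have hsI : Integrable (fun t => ∫ y, f (Fin.cons t y) ^ 2 ∂ν) γ :=
      integrable_of_abs_le hsm fun t => abs_integral_le_of_abs_le fun _ => hB2 _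
    have hhI := integrable_of_abs_le (μ := γ) hhm hhB
    have hhI2 := integrable_sq_of_abs_le (μ := γ) hhm hhB
    have hfirst : ENNReal.ofReal (∫ t, (∫ y, f (Fin.cons t y) ^ 2 ∂ν - h t ^ 2) ∂γ)
        ≤ ∑ i : Fin n, ∫⁻ x, G i.succ x ^ 2 ∂(Measure.pi fun _ : Fin (n + 1) => γ) := by
      calc _ ≤ ∫⁻ t, ENNReal.ofReal (∫ y, f (Fin.cons t y) ^ 2 ∂ν - h t ^ 2) ∂γ :=
            ofReal_integral_le_lintegral _
        _ ≤ ∫⁻ t, ∑ i : Fin n, ∫⁻ y, G i.succ (Fin.cons t y) ^ 2 ∂ν ∂γ := by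
            refine lintegral_mono fun t => ?_
            refine ih (f := fun y => f (Fin.cons t y)) (hf.comp (hct t)) (fun _ => hB _)
              (G := fun i y => G i.succ (Fin.cons t y)) (fun i => (hG _).comp (hct t)) ?_
            intro i x s r hsr
            simpa only [Fin.cons_update] using hfG i.succ (Fin.cons t x) s r hsr
        _ = _ := by
            rw [lintegral_finsetSum]
            · refine Finset.sum_congr rfl fun i _ => ?_
              rw [hlint ((hG _).pow_const 2)]
            · intro i _
              exact Measurable.lintegral_prod_right'
                (f := fun p : ℝ × (Fin n → ℝ) => G i.succ (Fin.cons p.1 p.2) ^ 2)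
                (((hG _).pow_const 2).comp hcons)
    have hsecond : ENNReal.ofReal (∫ t, h t ^ 2 ∂γ - (∫ t, h t ∂γ) ^ 2)
        ≤ ∫⁻ x, G 0 x ^ 2 ∂(Measure.pi fun _ : Fin (n + 1) => γ) := by
      -- The average of `G 0` is an upper gradient of `h` by Tonelli, with no differentiation under
      -- the integral; Jensen then moves the square inside.
      have hg0 : Measurable (fun u => ∫⁻ y, G 0 (Fin.cons u y) ∂ν) :=
        Measurable.lintegral_prod_right'
          (f := fun p : ℝ × (Fin n → ℝ) => G 0 (Fin.cons p.1 p.2)) ((hG 0).comp hcons)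
      refine (gaussianReal_poincare hhI hhI2 hg0 ?_).trans ?_
      · intro s t hst
        have hi : ∀ t, Integrable (fun y => f (Fin.cons t y)) ν := fun t =>
          integrable_of_abs_le (hf.comp (hct t)) fun _ => hB _
        calc ENNReal.ofReal |h t - h s|
            ≤ ENNReal.ofReal (∫ y, |f (Fin.cons t y) - f (Fin.cons s y)| ∂ν) := by
              refine ENNReal.ofReal_le_ofReal ?_
              rw [hh]; simp only
              rw [← integral_sub (hi t) (hi s)]
              exact abs_integral_le_integral_abs
          _ ≤ ∫⁻ y, ENNReal.ofReal |f (Fin.cons t y) - f (Fin.cons s y)| ∂ν :=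
              ofReal_integral_le_lintegral _
          _ ≤ ∫⁻ y, (∫⁻ u in Set.Ioc s t, G 0 (Fin.cons u y)) ∂ν := by
              refine lintegral_mono fun y => ?_
              simpa only [Fin.update_cons_zero] using hfG 0 (Fin.cons s y) s t hst
          _ = ∫⁻ u in Set.Ioc s t, ∫⁻ y, G 0 (Fin.cons u y) ∂ν := by
              rw [lintegral_lintegral_swap]
              exact ((hG 0).comp (hcons.comp measurable_swap)).aemeasurable
      · rw [hlint ((hG 0).pow_const 2)]
        refine lintegral_mono fun u => ?_
        simpa using sq_lintegral_le ν ((hG 0).comp (hct u)).aemeasurable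
    rw [hint (hf.pow_const 2) hB2, hint hf hB, Fin.sum_univ_succ]
    have hsplit : ∫ t, ∫ y, f (Fin.cons t y) ^ 2 ∂ν ∂γ - (∫ t, h t ∂γ) ^ 2
        = (∫ t, (∫ y, f (Fin.cons t y) ^ 2 ∂ν - h t ^ 2) ∂γ)
          + (∫ t, h t ^ 2 ∂γ - (∫ t, h t ∂γ) ^ 2) := by
      rw [integral_sub hsI hhI2]; ring
    rw [hsplit]
    exact ENNReal.ofReal_add_le.trans ((add_le_add hfirst hsecond).trans_eq (add_comm _ _))

/-! ### Gaussian Poincaré inequality for Lipschitz functions on `ℝᵈ` -/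

theorem pi_gaussianReal_absolutelyContinuous (n : ℕ) :
    (Measure.pi fun _ : Fin n => gaussianReal 0 1) ≪ (volume : Measure (Fin n → ℝ)) := by
  induction n with
  | zero =>
    rw [volume_pi, Measure.pi_of_empty, Measure.pi_of_empty]
  | succ n ih =>
    have h1 := measurePreserving_piFinSuccAbove (α := fun _ : Fin (n + 1) => ℝ)
      (fun _ => gaussianReal 0 1) 0
    have h2 := measurePreserving_piFinSuccAbove (α := fun _ : Fin (n + 1) => ℝ)
      (fun _ => (volume : Measure ℝ)) 0
    rw [volume_pi, ← h1.symm.map_eq, ← h2.symm.map_eq]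
    exact ((gaussianReal_absolutelyContinuous 0 one_ne_zero).prod ih).map
      (MeasurableEquiv.measurable _)

/-- Transfers Rademacher's almost everywhere differentiability from Lebesgue to Gaussian measure. -/
theorem stdGaussian_absolutelyContinuous (d : ℕ) :
    stdGaussian (EuclideanSpace ℝ (Fin d)) ≪ volume := by
  rw [← map_pi_eq_stdGaussian, ← (PiLp.volume_preserving_toLp (Fin d)).map_eq]
  exact (pi_gaussianReal_absolutelyContinuous d).map (by fun_prop)

/-- Near `x` the quadratic error is at most `ε * ‖y - x‖` for any `ε > 0`, hence invisible to the
derivative. -/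
theorem norm_fderiv_le_of_quadratic_bound {E : Type*} [NormedAddCommGroup E] [NormedSpace ℝ E]
    {g : E → ℝ} {x : E} (hg : DifferentiableAt ℝ g x) {a C : ℝ} (ha : 0 ≤ a)
    (h : ∀ y, |g y - g x| ≤ a * ‖y - x‖ + C * ‖y - x‖ ^ 2) : ‖fderiv ℝ g x‖ ≤ a := by
  refine le_of_forall_pos_le_add fun ε hε => ?_
  refine hg.hasFDerivAt.le_of_lip' (by positivity) ?_
  have : ∀ᶠ y in nhds x, C * ‖y - x‖ < ε := by
    have hc : Filter.Tendsto (fun y => C * ‖y - x‖) (nhds x) (nhds (C * ‖x - x‖)) :=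
      (by fun_prop : Continuous fun y => C * ‖y - x‖).tendsto x
    exact hc.eventually_lt_const (by simpa using hε)
  filter_upwards [this] with y hy
  have := h y
  rw [Real.norm_eq_abs]
  nlinarith [norm_nonneg (y - x)]

/-- Gaussian Poincaré inequality for a bounded Lipschitz function with local slope at most `a`. -/
theorem stdGaussian_poincare {d : ℕ} {g : EuclideanSpace ℝ (Fin d) → ℝ} {L : NNReal}
    (hg : LipschitzWith L g) {B : ℝ} (hB : ∀ x, |g x| ≤ B) {a : EuclideanSpace ℝ (Fin d) → ℝ}
    {C : ℝ} (ha : ∀ x, 0 ≤ a x)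
    (h : ∀ x y, |g y - g x| ≤ a x * ‖y - x‖ + C * ‖y - x‖ ^ 2) :
    ENNReal.ofReal (∫ x, g x ^ 2 ∂(stdGaussian (EuclideanSpace ℝ (Fin d)))
        - (∫ x, g x ∂(stdGaussian (EuclideanSpace ℝ (Fin d)))) ^ 2)
      ≤ ∫⁻ x, ENNReal.ofReal (a x ^ 2) ∂(stdGaussian (EuclideanSpace ℝ (Fin d))) := by
  have hgc := hg.continuous
  set e : Fin d → EuclideanSpace ℝ (Fin d) := fun i => EuclideanSpace.single i 1 with he
  have hup : ∀ (x : Fin d → ℝ) (i : Fin d) (u v : ℝ),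
      WithLp.toLp 2 (Function.update x i v)
        = WithLp.toLp 2 (Function.update x i u) + (v - u) • e i := by
    intro x i u v
    ext j
    by_cases hj : j = i
    · subst hj; simp [he]
    · simp [he, hj]
  -- `lineDeriv` takes the value `0` where the limit does not exist, so it is defined everywhere.
  have hG : ∀ i, Measurable fun x => ENNReal.ofReal |lineDeriv ℝ g x (e i)| := fun i => by
    have := measurable_lineDeriv (𝕜 := ℝ) (v := e i) hgc
    fun_prop
  have hmt : Measurable (WithLp.toLp 2 : (Fin d → ℝ) → EuclideanSpace ℝ (Fin d)) := by fun_prop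
  have key := pi_gaussianReal_poincare d (f := fun x => g (WithLp.toLp 2 x))
    (hgc.measurable.comp hmt) (fun x => hB _)
    (G := fun i x => ENNReal.ofReal |lineDeriv ℝ g (WithLp.toLp 2 x) (e i)|)
    (fun i => (hG i).comp hmt) ?_
  · rw [← map_pi_eq_stdGaussian]
    rw [integral_map hmt.aemeasurable (by fun_prop), integral_map hmt.aemeasurable (by fun_prop)]
    refine key.trans ?_
    calc _ = ∑ i, ∫⁻ x, ENNReal.ofReal |lineDeriv ℝ g x (e i)| ^ 2
            ∂(stdGaussian (EuclideanSpace ℝ (Fin d))) := by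
          refine Finset.sum_congr rfl fun i _ => ?_
          rw [← map_pi_eq_stdGaussian, lintegral_map ((hG i).pow_const 2) hmt]
      _ = ∫⁻ x, ∑ i, ENNReal.ofReal |lineDeriv ℝ g x (e i)| ^ 2
            ∂(stdGaussian (EuclideanSpace ℝ (Fin d))) :=
          (lintegral_finsetSum _ fun i _ => (hG i).pow_const 2).symm
      _ ≤ _ := by
          rw [map_pi_eq_stdGaussian]
          refine lintegral_mono_ae ?_
          -- Rademacher: at almost every point the squared partial derivatives add up to the squared
          -- norm of the derivative.
          filter_upwards [(stdGaussian_absolutelyContinuous d).ae_le hg.ae_differentiableAt]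
            with x hx
          have hn := norm_fderiv_le_of_quadratic_bound hx (ha x) (h x)
          have hsq : ‖fderiv ℝ g x‖ ^ 2 ≤ a x ^ 2 := pow_le_pow_left₀ (norm_nonneg _) hn 2
          have hsum : ∑ i, |lineDeriv ℝ g x (e i)| ^ 2 = ‖fderiv ℝ g x‖ ^ 2 := by
            have h1 : ‖gradient g x‖ = ‖fderiv ℝ g x‖ := by
              simp [gradient]
            rw [← h1, EuclideanSpace.real_norm_sq_eq]
            refine Finset.sum_congr rfl fun i _ => ?_
            rw [sq_abs, hx.lineDeriv_eq_fderiv]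
            congr 1
            have : fderiv ℝ g x (e i) = inner ℝ (gradient g x) (e i) := by
              simp [gradient]
            rw [this, he, EuclideanSpace.inner_single_right]
            simp
          simp_rw [← ENNReal.ofReal_pow (abs_nonneg _)]
          rw [← ENNReal.ofReal_sum_of_nonneg fun i _ => by positivity]
          exact ENNReal.ofReal_le_ofReal (hsum.trans_le hsq)
  · intro i x s t hst
    set φ : ℝ → ℝ := fun u => g (WithLp.toLp 2 (Function.update x i u)) with hφ
    have hφ' : ∀ u, φ = fun v => g (WithLp.toLp 2 (Function.update x i u) + (v - u) • e i) := by
      intro u; ext v; simp only [hφ]; rw [hup x i u v]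
    have hlip : LipschitzWith L φ := by
      refine LipschitzWith.of_dist_le_mul fun u v => ?_
      refine (hg.dist_le_mul _ _).trans ?_
      rw [hup x i v u, dist_eq_norm, add_sub_cancel_left, norm_smul, Real.dist_eq]
      simp [he]
    have hder : ∀ u, deriv φ u = lineDeriv ℝ g (WithLp.toLp 2 (Function.update x i u)) (e i) := by
      intro u
      rw [hφ' u, lineDeriv]
      have := deriv_comp_sub_const (f := fun w : ℝ =>
        g (WithLp.toLp 2 (Function.update x i u) + w • e i)) u u
      simpa using this
    -- Along each axis a Lipschitz function is absolutely continuous, so it is the integral of its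
    -- derivative.
    have hftc := (hlip.lipschitzOnWith (s := Set.uIcc s t)).absolutelyContinuousOnInterval
      |>.integral_deriv_eq_sub
    change ENNReal.ofReal |φ t - φ s| ≤ _
    rw [← hftc, intervalIntegral.integral_of_le hst.le]
    refine (ENNReal.ofReal_le_ofReal abs_integral_le_integral_abs).trans ?_
    refine (ofReal_integral_le_lintegral _).trans ?_
    simp_rw [hder]
    exact le_rfl

/-! ### Integrals against kernels -/

instance isMarkovKernel_pow {α : Type*} [MeasurableSpace α] (Q : Kernel α α) [IsMarkovKernel Q]
    (k : ℕ) : IsMarkovKernel (Q ^ k) := by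
  induction k with
  | zero => exact inferInstanceAs (IsMarkovKernel (Kernel.id : Kernel α α))
  | succ k ih =>
    rw [pow_succ]
    exact inferInstanceAs (IsMarkovKernel ((Q ^ k) ∘ₖ Q))

theorem integral_bind_kernel {α β : Type*} [MeasurableSpace α] [MeasurableSpace β]
    (μ : Measure α) (κ : Kernel α β) {f : β → ℝ} (hf : Integrable f (μ.bind κ)) :
    ∫ y, f y ∂(μ.bind κ) = ∫ x, ∫ y, f y ∂(κ x) ∂μ := by
  have h : ((κ ∘ₖ Kernel.const Unit μ) () : Measure β) = μ.bind κ := by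
    rw [Kernel.comp_apply, Kernel.const_apply]
  rw [← h] at hf ⊢
  rw [Kernel.integral_comp hf, Kernel.const_apply]

theorem kernel_pow_zero_apply {α : Type*} [MeasurableSpace α] (Q : Kernel α α) (x : α) :
    (Q ^ 0) x = Measure.dirac x := by
  rw [pow_zero]; exact Kernel.id_apply x

theorem kernel_pow_succ_apply {α : Type*} [MeasurableSpace α] (Q : Kernel α α) (k : ℕ) (x : α) :
    (Q ^ (k + 1)) x = (Q x).bind (Q ^ k : Kernel α α) := by
  rw [pow_succ]; exact Kernel.comp_apply _ _ _

theorem bind_kernel_pow_succ {α : Type*} [MeasurableSpace α] (Q : Kernel α α) (k : ℕ)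
    (μ : Measure α) :
    μ.bind (Q ^ (k + 1) : Kernel α α) = (μ.bind (Q ^ k : Kernel α α)).bind Q := by
  rw [Measure.comp_assoc, pow_succ']; rfl

theorem bind_kernel_pow_zero {α : Type*} [MeasurableSpace α] (Q : Kernel α α) (μ : Measure α) :
    μ.bind (Q ^ 0 : Kernel α α) = μ := by
  rw [pow_zero]; exact Measure.id_comp

theorem integral_kernel_pow_succ {α : Type*} [MeasurableSpace α] (Q : Kernel α α)
    [IsMarkovKernel Q] (k : ℕ) (x : α) {f : α → ℝ} (hf : Measurable f) {B : ℝ}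
    (hB : ∀ x, |f x| ≤ B) :
    ∫ y, f y ∂(Q ^ (k + 1)) x = ∫ z, ∫ y, f y ∂(Q ^ k) z ∂(Q x) := by
  have hI : Integrable f ((Q ^ (k + 1)) x) := integrable_of_abs_le hf hB
  rw [kernel_pow_succ_apply] at hI ⊢
  exact integral_bind_kernel _ _ hI

/-! ### The Wasserstein distance -/

section Wasserstein

variable {E : Type*} [NormedAddCommGroup E] [MeasurableSpace E]

theorem exists_coupling_of_wasserstein2_lt {μ ν : Measure E} {r : ℝ≥0∞}
    (h : wasserstein2 μ ν < r) :
    ∃ π : Measure (E × E), π.fst = μ ∧ π.snd = ν ∧ ∫⁻ z, edist z.1 z.2 ^ 2 ∂π < r ^ 2 := by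
  have h2 : (⨅ π ∈ {π : Measure (E × E) | π.fst = μ ∧ π.snd = ν},
      ∫⁻ z, edist z.1 z.2 ^ 2 ∂π) < r ^ 2 := by
    have h' : wasserstein2 μ ν ^ 2 < r ^ 2 := ENNReal.pow_lt_pow_left two_ne_zero h
    rwa [wasserstein2, ← ENNReal.rpow_natCast, ← ENNReal.rpow_mul,
      show (1 / 2 : ℝ) * ((2 : ℕ) : ℝ) = 1 by norm_num, ENNReal.rpow_one] at h'
  obtain ⟨π, hπ⟩ := iInf_lt_iff.1 h2
  obtain ⟨⟨h3, h4⟩, hlt⟩ := iInf_lt_iff.1 hπ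
  exact ⟨π, h3, h4, hlt⟩

theorem wasserstein2_le_of_coupling {μ ν : Measure E} {r : ℝ≥0∞} (π : Measure (E × E))
    (h1 : π.fst = μ) (h2 : π.snd = ν) (h : ∫⁻ z, edist z.1 z.2 ^ 2 ∂π ≤ r ^ 2) :
    wasserstein2 μ ν ≤ r := by
  calc wasserstein2 μ ν ≤ (r ^ 2) ^ (1 / 2 : ℝ) :=
        ENNReal.rpow_le_rpow ((iInf₂_le π ⟨h1, h2⟩).trans h) (by norm_num)
    _ = r := by
      rw [← ENNReal.rpow_natCast, ← ENNReal.rpow_mul]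
      norm_num

variable [BorelSpace E] [SecondCountableTopology E]

theorem wasserstein2_dirac_le (x y : E) :
    wasserstein2 (Measure.dirac x) (Measure.dirac y) ≤ ENNReal.ofReal ‖x - y‖ := by
  refine wasserstein2_le_of_coupling (Measure.dirac (x, y)) ?_ ?_ ?_
  · simp [Measure.fst, Measure.map_dirac' measurable_fst]
  · simp [Measure.snd, Measure.map_dirac' measurable_snd]
  · rw [lintegral_dirac' _ (by fun_prop)]
    rw [edist_dist, dist_eq_norm]

theorem integral_mul_le_sqrt_mul_sqrt {α : Type*} [MeasurableSpace α] {μ : Measure α}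
    {f g : α → ℝ} (hf : 0 ≤ f) (hg : 0 ≤ g) (hfm : AEStronglyMeasurable f μ)
    (hgm : AEStronglyMeasurable g μ) (hf2 : Integrable (fun x => f x ^ 2) μ)
    (hg2 : Integrable (fun x => g x ^ 2) μ) :
    ∫ x, f x * g x ∂μ ≤ √(∫ x, f x ^ 2 ∂μ) * √(∫ x, g x ^ 2 ∂μ) := by
  have h := integral_mul_le_Lp_mul_Lq_of_nonneg (μ := μ) Real.HolderConjugate.two_two
    (ae_of_all _ hf) (ae_of_all _ hg)
    (by simpa using (memLp_two_iff_integrable_sq hfm).2 hf2)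
    (by simpa using (memLp_two_iff_integrable_sq hgm).2 hg2)
  simpa [Real.sqrt_eq_rpow] using h

/-- If `f` has slope at most `A` up to a quadratic error, the difference of its integrals is
controlled by the `L²`-norm of `A` and the Wasserstein distance. -/
theorem abs_integral_sub_le_of_wasserstein2_le {μ ν : Measure E} [IsProbabilityMeasure μ]
    {f A : E → ℝ} (hf : Measurable f) (hfμ : Integrable f μ) (hfν : Integrable f ν)
    (hA : Measurable A) (hA0 : ∀ x, 0 ≤ A x) (hA2 : Integrable (fun x => A x ^ 2) μ) {C r : ℝ}
    (hC : 0 ≤ C) (hr : 0 ≤ r) (hfA : ∀ x y, |f y - f x| ≤ A x * ‖y - x‖ + C * ‖y - x‖ ^ 2)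
    (hW : wasserstein2 μ ν ≤ ENNReal.ofReal r) :
    |∫ x, f x ∂ν - ∫ x, f x ∂μ| ≤ √(∫ x, A x ^ 2 ∂μ) * r + C * r ^ 2 := by
  -- The infimum over couplings need not be attained: a coupling is available for each `s > r`, and
  -- `s` decreases to `r` at the end.
  have key : ∀ s, r < s →
      |∫ x, f x ∂ν - ∫ x, f x ∂μ| ≤ √(∫ x, A x ^ 2 ∂μ) * s + C * s ^ 2 := by
    intro s hs
    have hs0 : 0 < s := hr.trans_lt hs
    obtain ⟨π, h1, h2, h3⟩ := exists_coupling_of_wasserstein2_lt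
      (hW.trans_lt ((ENNReal.ofReal_lt_ofReal_iff hs0).2 hs))
    have hed : ∀ z : E × E, edist z.1 z.2 ^ 2 = ENNReal.ofReal (‖z.2 - z.1‖ ^ 2) := fun z => by
      rw [edist_comm, edist_dist, dist_eq_norm, ENNReal.ofReal_pow (norm_nonneg _)]
    simp_rw [hed] at h3
    rw [← ENNReal.ofReal_pow hs0.le] at h3
    have hN2 : Integrable (fun z : E × E => ‖z.2 - z.1‖ ^ 2) π := by
      refine ⟨by fun_prop, ?_⟩
      rw [hasFiniteIntegral_iff_ofReal (ae_of_all _ fun _ => by positivity)]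
      exact h3.trans ENNReal.ofReal_lt_top
    have hNle : ∫ z : E × E, ‖z.2 - z.1‖ ^ 2 ∂π ≤ s ^ 2 := by
      rw [integral_eq_lintegral_of_nonneg_ae (ae_of_all _ fun _ => by positivity) (by fun_prop)]
      exact ENNReal.toReal_le_of_le_ofReal (by positivity) h3.le
    have hi1 : ∀ {g : E → ℝ}, Measurable g → Integrable g μ →
        Integrable (fun z : E × E => g z.1) π := fun hg hgi => by
      rw [← h1, Measure.fst] at hgi
      exact (integrable_map_measure hg.aestronglyMeasurable measurable_fst.aemeasurable).1 hgi
    have hv1 : ∀ {g : E → ℝ}, Measurable g → ∫ z : E × E, g z.1 ∂π = ∫ x, g x ∂μ := fun hg => by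
      rw [← h1, Measure.fst, integral_map measurable_fst.aemeasurable hg.aestronglyMeasurable]
    have hi2 : Integrable (fun z : E × E => f z.2) π := by
      rw [← h2, Measure.snd] at hfν
      exact (integrable_map_measure hf.aestronglyMeasurable measurable_snd.aemeasurable).1 hfν
    have hv2 : ∫ z : E × E, f z.2 ∂π = ∫ x, f x ∂ν := by
      rw [← h2, Measure.snd, integral_map measurable_snd.aemeasurable hf.aestronglyMeasurable]
    have hA2' := hi1 (hA.pow_const 2) hA2
    have hmul : Integrable (fun z : E × E => A z.1 * ‖z.2 - z.1‖) π := by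
      refine (hA2'.add hN2).mono' (by fun_prop) (ae_of_all _ fun z => ?_)
      have h0 := hA0 z.1
      rw [Real.norm_eq_abs, abs_of_nonneg (by positivity)]
      simp only [Pi.add_apply]
      nlinarith [sq_nonneg (A z.1 - ‖z.2 - z.1‖), sq_nonneg (A z.1), sq_nonneg ‖z.2 - z.1‖]
    calc |∫ x, f x ∂ν - ∫ x, f x ∂μ| = |∫ z : E × E, (f z.2 - f z.1) ∂π| := by
          rw [integral_sub hi2 (hi1 hf hfμ), hv2, hv1 hf]
      _ ≤ ∫ z : E × E, |f z.2 - f z.1| ∂π := abs_integral_le_integral_abs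
      _ ≤ ∫ z : E × E, (A z.1 * ‖z.2 - z.1‖ + C * ‖z.2 - z.1‖ ^ 2) ∂π :=
          integral_mono (hi2.sub (hi1 hf hfμ)).abs (hmul.add (hN2.const_mul C))
            fun z => hfA z.1 z.2
      _ = ∫ z : E × E, A z.1 * ‖z.2 - z.1‖ ∂π + C * ∫ z : E × E, ‖z.2 - z.1‖ ^ 2 ∂π := by
          rw [integral_add hmul (hN2.const_mul C), integral_const_mul]
      _ ≤ √(∫ z : E × E, A z.1 ^ 2 ∂π) * √(∫ z : E × E, ‖z.2 - z.1‖ ^ 2 ∂π) + C * s ^ 2 := by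
          refine add_le_add ?_ (mul_le_mul_of_nonneg_left hNle hC)
          exact integral_mul_le_sqrt_mul_sqrt (fun z => hA0 z.1) (fun z => norm_nonneg _)
            (hA.comp measurable_fst).aestronglyMeasurable (by fun_prop) hA2' hN2
      _ ≤ √(∫ x, A x ^ 2 ∂μ) * s + C * s ^ 2 := by
          rw [hv1 (hA.pow_const 2)]
          gcongr
          exact Real.sqrt_le_iff.2 ⟨hs0.le, hNle⟩
  have hcont : Filter.Tendsto (fun s => √(∫ x, A x ^ 2 ∂μ) * s + C * s ^ 2)
      (nhdsWithin r (Set.Ioi r)) (nhds (√(∫ x, A x ^ 2 ∂μ) * r + C * r ^ 2)) :=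
    ((by fun_prop : Continuous fun s => √(∫ x, A x ^ 2 ∂μ) * s + C * s ^ 2).tendsto r).mono_left
      nhdsWithin_le_nhds
  refine ge_of_tendsto hcont ?_
  filter_upwards [self_mem_nhdsWithin] with s hs using key s hs

theorem abs_integral_sub_le_of_lipschitz {μ ν : Measure E} [IsProbabilityMeasure μ]
    {f : E → ℝ} {L : NNReal} (hf : LipschitzWith L f) (hfμ : Integrable f μ)
    (hfν : Integrable f ν) {r : ℝ} (hr : 0 ≤ r) (hW : wasserstein2 μ ν ≤ ENNReal.ofReal r) :
    |∫ x, f x ∂ν - ∫ x, f x ∂μ| ≤ L * r := by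
  have := abs_integral_sub_le_of_wasserstein2_le hf.continuous.measurable hfμ hfν
    (A := fun _ => L) measurable_const (fun _ => L.2) (integrable_const _) le_rfl hr
    (fun x y => by simpa [dist_eq_norm] using hf.dist_le_mul y x) hW
  simpa using this

end Wasserstein

/-! ### Variance bounds along a contracting Markov chain -/

section Variance

variable {E : Type*} [NormedAddCommGroup E] [MeasurableSpace E] [BorelSpace E]
  [SecondCountableTopology E]

/-- `μ` satisfies a variance bound with constant `V` for bounded Lipschitz functions, in terms of
a bound `a` on the local slope. -/
def SlopePoincare (μ : Measure E) (V : ℝ) : Prop :=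
  ∀ (g a : E → ℝ) (L : NNReal) (B A C : ℝ), LipschitzWith L g → (∀ x, |g x| ≤ B) →
    Measurable a → (∀ x, 0 ≤ a x) → (∀ x, a x ≤ A) →
    (∀ x y, |g y - g x| ≤ a x * ‖y - x‖ + C * ‖y - x‖ ^ 2) →
    ∫ x, g x ^ 2 ∂μ - (∫ x, g x ∂μ) ^ 2 ≤ V * ∫ x, a x ^ 2 ∂μ

/-- `Q` contracts the Wasserstein distance between Dirac masses at rate `ρ` up to a factor `M`. -/
def DiracContraction (Q : Kernel E E) (M ρ : ℝ) : Prop :=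
  ∀ (k : ℕ) (x y : E), wasserstein2 ((Q ^ k) x) ((Q ^ k) y) ≤ ENNReal.ofReal (M * ρ ^ k * ‖y - x‖)

variable {Q : Kernel E E} [IsMarkovKernel Q] {M ρ : ℝ}

theorem DiracContraction.lipschitz (hQ : DiracContraction Q M ρ) (hM : 0 ≤ M) (hρ : 0 ≤ ρ)
    {f : E → ℝ} {L : NNReal} (hf : LipschitzWith L f) {B : ℝ} (hB : ∀ x, |f x| ≤ B) (k : ℕ) :
    LipschitzWith (L * (M * ρ ^ k).toNNReal) (fun x => ∫ y, f y ∂(Q ^ k) x) := by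
  refine LipschitzWith.of_dist_le_mul fun x y => ?_
  have hm := hf.continuous.measurable
  have := abs_integral_sub_le_of_lipschitz hf (integrable_of_abs_le hm hB)
    (integrable_of_abs_le hm hB) (by positivity) (hQ k x y)
  rw [dist_comm, Real.dist_eq, dist_comm, dist_eq_norm, NNReal.coe_mul,
    Real.coe_toNNReal _ (by positivity)]
  linarith

/-- Conditioning on the first step splits the variance under `Q^(k+1)` into the `Q`-mean of the
variance under `Q^k`, handled by induction, and the variance under `Q` of `Q^k f`. The slope of `Q^k
f` at `y` is at most `M ρ^k √(Q^k a² y)`, so the second part contributes the term `ρ^{2k}` of the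
sum. -/
theorem DiracContraction.variance_pow_le (hQ : DiracContraction Q M ρ) (hM : 0 ≤ M) (hρ : 0 ≤ ρ)
    {V : ℝ} (hV : ∀ x, SlopePoincare (Q x) V) {f a : E → ℝ} {L : NNReal} {B A C : ℝ}
    (hf : LipschitzWith L f) (hB : ∀ x, |f x| ≤ B) (ha : Measurable a) (ha0 : ∀ x, 0 ≤ a x)
    (haA : ∀ x, a x ≤ A) (hC : 0 ≤ C)
    (hfa : ∀ x y, |f y - f x| ≤ a x * ‖y - x‖ + C * ‖y - x‖ ^ 2) (k : ℕ) (x : E) :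
    ∫ y, f y ^ 2 ∂(Q ^ k) x - (∫ y, f y ∂(Q ^ k) x) ^ 2
      ≤ V * M ^ 2 * (∑ i ∈ Finset.range k, (ρ ^ 2) ^ i) * ∫ y, a y ^ 2 ∂(Q ^ k) x := by
  have hm := hf.continuous.measurable
  have ha2 : ∀ y, |a y ^ 2| ≤ A ^ 2 := fun y => by
    rw [abs_of_nonneg (sq_nonneg _)]; exact pow_le_pow_left₀ (ha0 y) (haA y) 2
  have hf2 : ∀ y, |f y ^ 2| ≤ B ^ 2 := fun y => by
    rw [abs_pow]; exact pow_le_pow_left₀ (abs_nonneg _) (hB y) 2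
  induction k generalizing x with
  | zero =>
    rw [kernel_pow_zero_apply, integral_dirac' _ _ hm.stronglyMeasurable,
      integral_dirac' _ _ (hm.pow_const 2).stronglyMeasurable]
    simp
  | succ k ih =>
    set S := ∑ i ∈ Finset.range k, (ρ ^ 2) ^ i
    set g : E → ℝ := fun y => ∫ z, f z ∂(Q ^ k) y with hg
    set q : E → ℝ := fun y => ∫ z, a z ^ 2 ∂(Q ^ k) y with hq
    have hgl := hQ.lipschitz hM hρ hf hB k
    have hgB : ∀ y, |g y| ≤ B := fun y => abs_integral_le_of_abs_le hB
    have hqm : Measurable q :=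
      (StronglyMeasurable.integral_kernel (ha.pow_const 2).stronglyMeasurable).measurable
    have hq0 : ∀ y, 0 ≤ q y := fun y => integral_nonneg fun z => sq_nonneg _
    have hqA : ∀ y, |q y| ≤ A ^ 2 := fun y => abs_integral_le_of_abs_le ha2
    have hsm : Measurable fun y => ∫ z, f z ^ 2 ∂(Q ^ k) y :=
      (StronglyMeasurable.integral_kernel (hm.pow_const 2).stronglyMeasurable).measurable
    -- The transport estimate with `r = M ρ^k ‖z - y‖` supplies both the slope and the quadratic
    -- constant `C (M ρ^k)²`. The bound with `√(A ^ 2)` only records that the slope is bounded.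
    have hstep := hV x g (fun y => M * ρ ^ k * √(q y)) _ B (M * ρ ^ k * √(A ^ 2))
      (C * (M * ρ ^ k) ^ 2) hgl hgB (by fun_prop) (fun y => by positivity)
      (fun y => by gcongr; exact (le_abs_self _).trans (hqA y)) (fun y z => by
        have := abs_integral_sub_le_of_wasserstein2_le hm (integrable_of_abs_le hm hB)
          (integrable_of_abs_le hm hB) ha ha0 (integrable_of_abs_le (ha.pow_const 2) ha2) hC
          (by positivity) hfa (hQ k y z)
        refine this.trans_eq ?_
        simp only [hq]
        ring)
    have hsq : ∀ y, (M * ρ ^ k * √(q y)) ^ 2 = (M * ρ ^ k) ^ 2 * q y := fun y => by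
      rw [mul_pow, Real.sq_sqrt (hq0 y)]
    simp_rw [hsq] at hstep
    rw [integral_const_mul] at hstep
    rw [integral_kernel_pow_succ Q k x (hm.pow_const 2) hf2, integral_kernel_pow_succ Q k x hm hB,
      integral_kernel_pow_succ Q k x (ha.pow_const 2) ha2]
    have hgi2 : Integrable (fun y => g y ^ 2) (Q x) :=
      integrable_sq_of_abs_le hgl.continuous.measurable hgB
    have hqi : Integrable q (Q x) := integrable_of_abs_le hqm hqA
    have hmono : ∫ y, ∫ z, f z ^ 2 ∂(Q ^ k) y ∂(Q x)
        ≤ ∫ y, (g y ^ 2 + V * M ^ 2 * S * q y) ∂(Q x) := by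
      refine integral_mono (integrable_of_abs_le hsm fun y => abs_integral_le_of_abs_le hf2)
        (hgi2.add (hqi.const_mul _)) fun y => ?_
      have := ih y
      simp only [hg, hq]
      linarith
    rw [integral_add hgi2 (hqi.const_mul _), integral_const_mul] at hmono
    rw [Finset.sum_range_succ]
    have e1 : V * ((M * ρ ^ k) ^ 2 * ∫ y, q y ∂(Q x))
        = V * M ^ 2 * (ρ ^ 2) ^ k * ∫ y, q y ∂(Q x) := by ring
    rw [e1] at hstep
    calc _ ≤ (∫ y, g y ^ 2 ∂(Q x) + V * M ^ 2 * S * ∫ y, q y ∂(Q x)) - (∫ y, g y ∂(Q x)) ^ 2 := by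
          linarith
      _ ≤ V * M ^ 2 * (S + (ρ ^ 2) ^ k) * ∫ y, q y ∂(Q x) := by linarith

end Variance

/-! ### From compactly supported functions to functions of polynomial growth -/

/-- Dilating one bump by `n + 1 ≥ 1` does not increase its gradient, so `K` is independent of `n`,
as dominated convergence requires. -/
theorem exists_smooth_cutoff (E : Type*) [NormedAddCommGroup E] [InnerProductSpace ℝ E]
    [FiniteDimensional ℝ E] :
    ∃ (χ : ℕ → E → ℝ) (K : ℝ), (∀ n, ContDiff ℝ ∞ (χ n)) ∧ (∀ n, HasCompactSupport (χ n)) ∧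
      (∀ n x, 0 ≤ χ n x) ∧ (∀ n x, χ n x ≤ 1) ∧ (∀ (n : ℕ) x, ‖x‖ < n + 1 → χ n x = 1) ∧
      ∀ n x, ‖fderiv ℝ (χ n) x‖ ≤ K := by
  let c : ContDiffBump (0 : E) := ⟨1, 2, by norm_num, by norm_num⟩
  obtain ⟨K, hK⟩ := (c.contDiff (n := 1)).lipschitzWith_of_hasCompactSupport
    c.hasCompactSupport (by simp)
  have hpos : ∀ n : ℕ, (0 : ℝ) < ((n : ℝ) + 1)⁻¹ := fun n => by positivity
  refine ⟨fun n x => c (((n : ℝ) + 1)⁻¹ • x), K, fun n => ?_, fun n => ?_, fun n x => c.nonneg,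
    fun n x => c.le_one, fun n x hx => ?_, fun n x => ?_⟩
  · exact c.contDiff.comp (contDiff_const_smul _)
  · exact c.hasCompactSupport.comp_smul (hpos n).ne'
  · refine c.one_of_mem_closedBall ?_
    rw [mem_closedBall_zero_iff, norm_smul, Real.norm_of_nonneg (hpos n).le]
    change _ ≤ (1 : ℝ)
    rw [inv_mul_le_iff₀ (by positivity)]
    linarith
  · refine norm_fderiv_le_of_lipschitz ℝ (LipschitzWith.of_dist_le_mul fun y z => ?_)
    refine (hK.dist_le_mul _ _).trans ?_
    rw [dist_smul₀, Real.norm_of_nonneg (hpos n).le]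
    have : ((n : ℝ) + 1)⁻¹ ≤ 1 := inv_le_one_of_one_le₀ (by linarith [n.cast_nonneg (α := ℝ)])
    exact mul_le_mul_of_nonneg_left (mul_le_of_le_one_left dist_nonneg this) K.2

section Poincare

variable {d : ℕ}

theorem norm_gradient_eq_norm_fderiv (f : EuclideanSpace ℝ (Fin d) → ℝ)
    (x : EuclideanSpace ℝ (Fin d)) : ‖gradient f x‖ = ‖fderiv ℝ f x‖ := by
  simp [gradient]

theorem continuous_norm_fderiv {f : EuclideanSpace ℝ (Fin d) → ℝ} (hf : ContDiff ℝ ∞ f) :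
    Continuous fun x => ‖fderiv ℝ f x‖ := (hf.continuous_fderiv (by simp)).norm

/-- The derivative is Lipschitz by compact support, so first-order Taylor expansion has a quadratic
remainder. This makes `‖fderiv ℝ f x‖` an admissible slope. -/
theorem abs_sub_le_of_contDiff_of_hasCompactSupport {f : EuclideanSpace ℝ (Fin d) → ℝ}
    (hf : ContDiff ℝ ∞ f) (hc : HasCompactSupport f) :
    ∃ C : ℝ, 0 ≤ C ∧ ∀ x y, |f y - f x| ≤ ‖fderiv ℝ f x‖ * ‖y - x‖ + C * ‖y - x‖ ^ 2 := by
  have hf1 : ContDiff ℝ 1 (fderiv ℝ f) :=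
    (hf.of_le (n := ∞) (m := 2) (WithTop.coe_le_coe.2 le_top)).fderiv_right (by norm_num)
  obtain ⟨K, hK⟩ := hf1.lipschitzWith_of_hasCompactSupport (hc.fderiv (𝕜 := ℝ)) (by simp)
  refine ⟨K, K.2, fun x y => ?_⟩
  have h := Convex.norm_image_sub_le_of_norm_fderiv_le' (𝕜 := ℝ) (f := f) (φ := fderiv ℝ f x)
    (C := K * ‖y - x‖) (s := segment ℝ x y)
    (fun z _ => (hf.differentiable (by simp)).differentiableAt)
    (fun z hz => by
      have h1 := hK.dist_le_mul z x
      rw [dist_eq_norm, dist_eq_norm] at h1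
      refine h1.trans (mul_le_mul_of_nonneg_left ?_ K.2)
      obtain ⟨t, ⟨ht0, ht1⟩, rfl⟩ := (segment_eq_image' ℝ x y ▸ hz :)
      rw [add_sub_cancel_left, norm_smul, Real.norm_of_nonneg ht0]
      exact mul_le_of_le_one_left (norm_nonneg _) ht1)
    (convex_segment x y) (left_mem_segment ℝ x y) (right_mem_segment ℝ x y)
  have h2 := (fderiv ℝ f x).le_opNorm (y - x)
  calc |f y - f x| = ‖(f y - f x - fderiv ℝ f x (y - x)) + fderiv ℝ f x (y - x)‖ := by
        rw [sub_add_cancel, Real.norm_eq_abs]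
    _ ≤ K * ‖y - x‖ * ‖y - x‖ + ‖fderiv ℝ f x‖ * ‖y - x‖ :=
        (norm_add_le _ _).trans (add_le_add h h2)
    _ = _ := by ring

/-- Apply the inequality to `χ n * f` and let `n` grow. The gradient is dominated by `‖fderiv ℝ f x‖
+ K * |f x|`, which is square integrable once the energy of `f` is finite. -/
theorem poincareInequality_of_hasCompactSupport {μ : Measure (EuclideanSpace ℝ (Fin d))}
    [IsProbabilityMeasure μ] {C : ℝ} (hC : 0 < C)
    (hmom : ∀ m : ℕ, Integrable (fun x => (1 + ‖x‖) ^ m) μ)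
    (h : ∀ f : EuclideanSpace ℝ (Fin d) → ℝ, ContDiff ℝ ∞ f → HasCompactSupport f →
      ∫ x, f x ^ 2 ∂μ - (∫ x, f x ∂μ) ^ 2 ≤ C * ∫ x, ‖fderiv ℝ f x‖ ^ 2 ∂μ) :
    PoincareInequality μ C := by
  intro f hf ⟨A, m, hA⟩
  have hfc := hf.continuous
  have hfi : Integrable f μ := ((hmom m).const_mul A).mono' hfc.aestronglyMeasurable
    (ae_of_all _ hA)
  have hfi2 : Integrable (fun x => f x ^ 2) μ := by
    refine ((hmom (m * 2)).const_mul (A ^ 2)).mono' (by fun_prop) (ae_of_all _ fun x => ?_)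
    rw [norm_pow, Real.norm_eq_abs, pow_mul, ← mul_pow]
    exact pow_le_pow_left₀ (abs_nonneg _) (hA x) 2
  refine ⟨hfi, hfi2, ?_⟩
  simp_rw [norm_gradient_eq_norm_fderiv]
  -- With infinite energy the right-hand side is `⊤`, since `C > 0`.
  by_cases hfin : ∫⁻ x, ENNReal.ofReal (‖fderiv ℝ f x‖ ^ 2) ∂μ = ⊤
  · rw [hfin, ENNReal.mul_top (by simpa using hC)]
    exact le_top
  have hDc := continuous_norm_fderiv hf
  have hDi : Integrable (fun x => ‖fderiv ℝ f x‖ ^ 2) μ := by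
    refine ⟨by fun_prop, ?_⟩
    rw [hasFiniteIntegral_iff_ofReal (ae_of_all _ fun _ => by positivity)]
    exact lt_top_iff_ne_top.2 hfin
  obtain ⟨χ, K, hχ, hχc, hχ0, hχ1, hχone, hχK⟩ :=
    exists_smooth_cutoff (EuclideanSpace ℝ (Fin d))
  have hK0 : 0 ≤ K := (norm_nonneg _).trans (hχK 0 0)
  have hev : ∀ x : EuclideanSpace ℝ (Fin d), ∀ᶠ n : ℕ in Filter.atTop,
      (fun y => χ n y * f y) =ᶠ[nhds x] f := by
    intro x
    obtain ⟨N, hN⟩ := exists_nat_gt ‖x‖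
    filter_upwards [Filter.eventually_ge_atTop N] with n hn
    have hx : ‖x‖ < (n : ℝ) + 1 := by
      have : (N : ℝ) ≤ n := by exact_mod_cast hn
      linarith
    filter_upwards [(isOpen_lt continuous_norm continuous_const).mem_nhds hx] with y hy
    rw [hχone n y hy, one_mul]
  have hFc : ∀ n, ContDiff ℝ ∞ fun y => χ n y * f y := fun n => (hχ n).mul hf
  have hineq := fun n => h (fun y => χ n y * f y) (hFc n) ((hχc n).mul_right)
  have habs : ∀ n x, |χ n x * f x| ≤ |f x| := fun n x => by
    rw [abs_mul, abs_of_nonneg (hχ0 n x)]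
    exact mul_le_of_le_one_left (abs_nonneg _) (hχ1 n x)
  have hl1 : Filter.Tendsto (fun n => ∫ x, χ n x * f x ∂μ) Filter.atTop (nhds (∫ x, f x ∂μ)) :=
    tendsto_integral_of_dominated_convergence (fun x => |f x|)
      (fun n => (hFc n).continuous.aestronglyMeasurable) hfi.abs
      (fun n => ae_of_all _ (habs n))
      (ae_of_all _ fun x => tendsto_const_nhds.congr' <| by
        filter_upwards [hev x] with n hn using hn.self_of_nhds.symm)
  have hl2 : Filter.Tendsto (fun n => ∫ x, (χ n x * f x) ^ 2 ∂μ) Filter.atTop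
      (nhds (∫ x, f x ^ 2 ∂μ)) :=
    tendsto_integral_of_dominated_convergence (fun x => f x ^ 2)
      (fun n => ((hFc n).continuous.pow 2).aestronglyMeasurable) hfi2
      (fun n => ae_of_all _ fun x => by
        rw [norm_pow, Real.norm_eq_abs, ← sq_abs (f x)]
        exact pow_le_pow_left₀ (abs_nonneg _) (habs n x) 2)
      (ae_of_all _ fun x => tendsto_const_nhds.congr' <| by
        filter_upwards [hev x] with n hn
        rw [show χ n x * f x = f x from hn.self_of_nhds])
  have hl3 : Filter.Tendsto (fun n => ∫ x, ‖fderiv ℝ (fun y => χ n y * f y) x‖ ^ 2 ∂μ)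
      Filter.atTop (nhds (∫ x, ‖fderiv ℝ f x‖ ^ 2 ∂μ)) := by
    refine tendsto_integral_of_dominated_convergence
      (fun x => 2 * ‖fderiv ℝ f x‖ ^ 2 + 2 * (K ^ 2 * f x ^ 2))
      (fun n => ((continuous_norm_fderiv (hFc n)).pow 2).aestronglyMeasurable)
      ((hDi.const_mul 2).add ((hfi2.const_mul _).const_mul 2))
      (fun n => ae_of_all _ fun x => ?_)
      (ae_of_all _ fun x => tendsto_const_nhds.congr' <| by
        filter_upwards [hev x] with n hn
        rw [hn.fderiv_eq])
    have hd : ‖fderiv ℝ (fun y => χ n y * f y) x‖ ≤ ‖fderiv ℝ f x‖ + K * |f x| := by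
      rw [fderiv_fun_mul ((hχ n).differentiable (by simp)).differentiableAt
        (hf.differentiable (by simp)).differentiableAt]
      refine (norm_add_le _ _).trans ?_
      rw [norm_smul, norm_smul, Real.norm_of_nonneg (hχ0 n x), Real.norm_eq_abs]
      refine add_le_add (mul_le_of_le_one_left (norm_nonneg _) (hχ1 n x)) ?_
      rw [mul_comm]
      exact mul_le_mul_of_nonneg_right (hχK n x) (abs_nonneg _)
    rw [Real.norm_of_nonneg (by positivity), ← sq_abs (f x)]
    calc _ ≤ (‖fderiv ℝ f x‖ + K * |f x|) ^ 2 := pow_le_pow_left₀ (norm_nonneg _) hd 2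
      _ ≤ _ := by nlinarith [sq_nonneg (‖fderiv ℝ f x‖ - K * |f x|)]
  have hfinal := le_of_tendsto_of_tendsto' (hl2.sub (hl1.pow 2)) (hl3.const_mul C) hineq
  rw [← ofReal_integral_eq_lintegral_ofReal hDi (ae_of_all _ fun _ => by positivity),
    ← ENNReal.ofReal_mul hC.le]
  exact ENNReal.ofReal_le_ofReal hfinal

end Poincare

/-! ### The Euler kernel -/

section Euler

variable {d : ℕ} {b : EuclideanSpace ℝ (Fin d) → EuclideanSpace ℝ (Fin d)} {δ T : ℝ}

theorem isMarkovKernel_eulerKernel (hb : Measurable b) (δ T : ℝ) :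
    IsMarkovKernel (eulerKernel b δ T) :=
  Kernel.IsMarkovKernel.map _ (by fun_prop)

theorem integral_eulerKernel (hb : Measurable b) (x : EuclideanSpace ℝ (Fin d))
    {f : EuclideanSpace ℝ (Fin d) → ℝ} (hf : Measurable f) :
    ∫ y, f y ∂(eulerKernel b δ T x)
      = ∫ z, f (x + δ • b x + √(2 * T * δ) • z) ∂(stdGaussian (EuclideanSpace ℝ (Fin d))) := by
  rw [eulerKernel_apply hb, integral_map (by fun_prop) hf.aestronglyMeasurable]

theorem lintegral_eulerKernel (hb : Measurable b) (x : EuclideanSpace ℝ (Fin d))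
    {f : EuclideanSpace ℝ (Fin d) → ℝ≥0∞} (hf : Measurable f) :
    ∫⁻ y, f y ∂(eulerKernel b δ T x)
      = ∫⁻ z, f (x + δ • b x + √(2 * T * δ) • z) ∂(stdGaussian (EuclideanSpace ℝ (Fin d))) := by
  rw [eulerKernel_apply hb, lintegral_map hf (by fun_prop)]

/-- The kernel is a translate of the standard Gaussian scaled by `σ = √(2Tδ)`; slopes scale by `σ`
and energies by `σ²`. -/
theorem slopePoincare_eulerKernel (hb : Measurable b) (hδ : 0 ≤ δ) (hT : 0 ≤ T)
    (x : EuclideanSpace ℝ (Fin d)) : SlopePoincare (eulerKernel b δ T x) (2 * T * δ) := by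
  intro g a L B A C hg hB ha ha0 haA hga
  set σ := √(2 * T * δ) with hσ
  have hσ0 : 0 ≤ σ := Real.sqrt_nonneg _
  set m := x + δ • b x with hm
  have hgm := hg.continuous.measurable
  rw [integral_eulerKernel hb x hgm, integral_eulerKernel hb x (hgm.pow_const 2),
    integral_eulerKernel hb x (ha.pow_const 2)]
  simp only [← hσ, ← hm]
  have hsub : ∀ z w : EuclideanSpace ℝ (Fin d), ‖(m + σ • w) - (m + σ • z)‖ = σ * ‖w - z‖ := by
    intro z w
    rw [add_sub_add_left_eq_sub, ← smul_sub, norm_smul, Real.norm_of_nonneg hσ0]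
  have key := stdGaussian_poincare (g := fun z => g (m + σ • z)) (L := L * σ.toNNReal)
    (LipschitzWith.of_dist_le_mul fun z w => by
      refine (hg.dist_le_mul _ _).trans_eq ?_
      rw [dist_eq_norm, hsub, dist_eq_norm, NNReal.coe_mul, Real.coe_toNNReal _ hσ0, mul_assoc])
    (fun z => hB _) (a := fun z => σ * a (m + σ • z)) (C := C * σ ^ 2)
    (fun z => mul_nonneg hσ0 (ha0 _))
    (fun z w => by
      refine (hga (m + σ • z) (m + σ • w)).trans_eq ?_
      rw [hsub]; ring)
  have ha2 : Integrable (fun z => a (m + σ • z) ^ 2)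
      (stdGaussian (EuclideanSpace ℝ (Fin d))) :=
    integrable_of_abs_le (by fun_prop) (B := A ^ 2) fun z => by
      rw [abs_of_nonneg (sq_nonneg _)]; exact pow_le_pow_left₀ (ha0 _) (haA _) 2
  simp_rw [mul_pow] at key
  rw [← ofReal_integral_eq_lintegral_ofReal (ha2.const_mul _)
    (ae_of_all _ fun _ => by positivity), integral_const_mul, hσ,
    Real.sq_sqrt (by positivity)] at key
  exact (ENNReal.ofReal_le_ofReal_iff (mul_nonneg (by positivity)
    (integral_nonneg fun _ => by positivity))).1 key

theorem lintegral_one_add_norm_pow_stdGaussian_lt_top (σ : ℝ) (m : ℕ) :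
    ∫⁻ z, ENNReal.ofReal ((1 + |σ| * ‖z‖) ^ m) ∂(stdGaussian (EuclideanSpace ℝ (Fin d))) < ⊤ := by
  have hint : Integrable (fun z => (1 + |σ| * ‖z‖) ^ m)
      (stdGaussian (EuclideanSpace ℝ (Fin d))) := by
    have hL : MemLp (fun z : EuclideanSpace ℝ (Fin d) => 1 + |σ| * ‖z‖) m
        (stdGaussian (EuclideanSpace ℝ (Fin d))) :=
      MemLp.add (f := fun _ => (1 : ℝ)) (g := fun z => |σ| * ‖z‖) (memLp_const 1)
        (MemLp.const_mul (f := fun z => ‖z‖)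
          (IsGaussian.memLp_id (stdGaussian (EuclideanSpace ℝ (Fin d))) m (by simp)).norm _)
    have := hL.integrable_norm_pow'
    refine this.congr (ae_of_all _ fun z => ?_)
    simp only
    rw [Real.norm_of_nonneg (by positivity)]
  rw [← ofReal_integral_eq_lintegral_ofReal hint (ae_of_all _ fun _ => by positivity)]
  exact ENNReal.ofReal_lt_top

theorem exists_lintegral_eulerKernel_pow_norm_le {Lb : ℝ} (hLb : 0 ≤ Lb)
    (hLip : ∀ x y, ‖b x - b y‖ ≤ Lb * ‖x - y‖) (hb : Measurable b) (hδ : 0 ≤ δ) (m : ℕ) :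
    ∃ C : ℝ≥0∞, C ≠ ⊤ ∧ ∀ x, ∫⁻ y, ENNReal.ofReal ((1 + ‖y‖) ^ m) ∂(eulerKernel b δ T x)
      ≤ C * ENNReal.ofReal ((1 + ‖x‖) ^ m) := by
  set σ := √(2 * T * δ) with hσ
  -- Linear growth of `b` gives `1 + ‖x‖ + δ‖b x‖ ≤ (1 + ‖x‖) c`.
  set c := 1 + δ * Lb + δ * ‖b 0‖ with hc
  have hc0 : 0 ≤ δ * ‖b 0‖ := by positivity
  have hc1 : 0 ≤ δ * Lb := by positivity
  refine ⟨ENNReal.ofReal (c ^ m) * ∫⁻ z, ENNReal.ofReal ((1 + |σ| * ‖z‖) ^ m)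
    ∂(stdGaussian (EuclideanSpace ℝ (Fin d))), ENNReal.mul_ne_top ENNReal.ofReal_ne_top
      (lintegral_one_add_norm_pow_stdGaussian_lt_top σ m).ne, fun x => ?_⟩
  rw [lintegral_eulerKernel hb x (by fun_prop), mul_right_comm (ENNReal.ofReal _),
    ← ENNReal.ofReal_mul (by positivity), ← lintegral_const_mul _ (by fun_prop)]
  refine lintegral_mono fun z => ?_
  rw [← ENNReal.ofReal_mul (by positivity), ← mul_pow, ← mul_pow]
  refine ENNReal.ofReal_le_ofReal (pow_le_pow_left₀ (by positivity) ?_ m)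
  have hbx : ‖b x‖ ≤ ‖b 0‖ + Lb * ‖x‖ := by
    have := hLip x 0
    rw [sub_zero] at this
    linarith [norm_le_insert' (b x) (b 0)]
  have h1 : ‖x + δ • b x + σ • z‖ ≤ ‖x‖ + δ * ‖b x‖ + |σ| * ‖z‖ := by
    refine (norm_add₃_le).trans ?_
    rw [norm_smul, norm_smul, Real.norm_of_nonneg hδ, Real.norm_eq_abs]
  have h2 : 1 + ‖x‖ + δ * ‖b x‖ ≤ (1 + ‖x‖) * c := by
    have := mul_le_mul_of_nonneg_left hbx hδ
    rw [hc]
    nlinarith [norm_nonneg x, mul_nonneg hc0 (norm_nonneg x)]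
  have h3 : 1 ≤ (1 + ‖x‖) * c := by
    rw [hc]
    nlinarith [norm_nonneg x, mul_nonneg hc0 (norm_nonneg x), mul_nonneg hc1 (norm_nonneg x)]
  have h4 : 0 ≤ |σ| * ‖z‖ := by positivity
  change 1 + ‖x + δ • b x + σ • z‖ ≤ _
  nlinarith

/-- The bound `C ^ k` is not uniform in time and gives finiteness only; uniform moments are obtained
from the Poincaré inequality. -/
theorem integrable_one_add_norm_pow_eulerKernel_pow {Lb : ℝ} (hLb : 0 ≤ Lb)
    (hLip : ∀ x y, ‖b x - b y‖ ≤ Lb * ‖x - y‖) (hb : Measurable b) (hδ : 0 ≤ δ) (m k : ℕ)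
    (x : EuclideanSpace ℝ (Fin d)) :
    Integrable (fun y => (1 + ‖y‖) ^ m) ((eulerKernel b δ T ^ k) x) := by
  obtain ⟨C, hC, hCx⟩ := exists_lintegral_eulerKernel_pow_norm_le (T := T) hLb hLip hb hδ m
  have hle : ∀ x, ∫⁻ y, ENNReal.ofReal ((1 + ‖y‖) ^ m) ∂((eulerKernel b δ T ^ k) x)
      ≤ C ^ k * ENNReal.ofReal ((1 + ‖x‖) ^ m) := by
    induction k with
    | zero => intro x; rw [kernel_pow_zero_apply, lintegral_dirac' _ (by fun_prop)]; simp
    | succ k ih =>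
      intro x
      rw [kernel_pow_succ_apply, Measure.lintegral_bind (Kernel.aemeasurable _) (by fun_prop)]
      calc _ ≤ ∫⁻ z, C ^ k * ENNReal.ofReal ((1 + ‖z‖) ^ m) ∂(eulerKernel b δ T x) :=
            lintegral_mono fun z => ih z
        _ ≤ C ^ k * (C * ENNReal.ofReal ((1 + ‖x‖) ^ m)) := by
            rw [lintegral_const_mul _ (by fun_prop)]
            gcongr
            exact hCx x
        _ = _ := by rw [pow_succ, mul_assoc]
  refine ⟨by fun_prop, ?_⟩
  rw [hasFiniteIntegral_iff_ofReal (ae_of_all _ fun _ => by positivity)]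
  exact (hle x).trans_lt (ENNReal.mul_lt_top (ENNReal.pow_lt_top hC.lt_top) ENNReal.ofReal_lt_top)

/-- Local Poincaré inequality for compactly supported functions from a Wasserstein contraction. -/
theorem DiracContraction.variance_eulerKernel_pow_le (hb : Measurable b) (hδ : 0 < δ) (hT : 0 ≤ T)
    {M h : ℝ} (hM : 0 ≤ M) (hh : 0 < h) (hhδ : h * δ < 1)
    (hQ : DiracContraction (eulerKernel b δ T) M (1 - h * δ))
    {f : EuclideanSpace ℝ (Fin d) → ℝ} (hf : ContDiff ℝ ∞ f) (hfc : HasCompactSupport f) (k : ℕ)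
    (x : EuclideanSpace ℝ (Fin d)) :
    ∫ y, f y ^ 2 ∂((eulerKernel b δ T ^ k) x) - (∫ y, f y ∂((eulerKernel b δ T ^ k) x)) ^ 2
      ≤ 2 * T * M ^ 2 / (2 * h - h ^ 2 * δ) *
        ∫ y, ‖fderiv ℝ f y‖ ^ 2 ∂((eulerKernel b δ T ^ k) x) := by
  have := isMarkovKernel_eulerKernel hb δ T
  obtain ⟨L, hL⟩ := hf.lipschitzWith_of_hasCompactSupport hfc (by simp)
  obtain ⟨B, hB⟩ := hf.continuous.bounded_above_of_compact_support hfc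
  obtain ⟨C, hC0, hC⟩ := abs_sub_le_of_contDiff_of_hasCompactSupport hf hfc
  have key := hQ.variance_pow_le hM (by linarith) (slopePoincare_eulerKernel hb hδ.le hT) hL hB
    (continuous_norm_fderiv hf).measurable (fun _ => norm_nonneg _)
    (fun y => norm_fderiv_le_of_lipschitz ℝ hL) hC0 hC k x
  refine key.trans (mul_le_mul_of_nonneg_right ?_ (integral_nonneg fun _ => by positivity))
  have hgeom := geom_sum_mul ((1 - h * δ) ^ 2) k
  set S := ∑ i ∈ Finset.range k, ((1 - h * δ) ^ 2) ^ i
  have hpow : 0 ≤ ((1 - h * δ) ^ 2) ^ k := by positivity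
  have hden : 0 < 2 * h - h ^ 2 * δ := by nlinarith [mul_pos hh hδ]
  rw [le_div_iff₀ hden]
  -- Here `1 - (1 - hδ)² = δ(2h - h²δ)`, so the left side is `1 - (1 - hδ)^{2k}`. Its factor `δ`
  -- cancels that of the one-step constant `2Tδ`.
  have hS : S * (δ * (2 * h - h ^ 2 * δ)) ≤ 1 := by nlinarith
  calc 2 * T * δ * M ^ 2 * S * (2 * h - h ^ 2 * δ)
      = 2 * T * M ^ 2 * (S * (δ * (2 * h - h ^ 2 * δ))) := by ring
    _ ≤ 2 * T * M ^ 2 := mul_le_of_le_one_right (by positivity) hS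

end Euler

/-! ### Ergodicity of a contracting Markov chain -/

section Ergodic

/-- The constant sequence `μ` converges weakly to `ν`, and weak limits are unique. -/
theorem measure_eq_of_forall_lipschitz_integral_eq {E : Type*} [NormedAddCommGroup E]
    [MeasurableSpace E] [BorelSpace E] {μ ν : Measure E} [IsProbabilityMeasure μ]
    [IsProbabilityMeasure ν]
    (h : ∀ (f : E → ℝ) (L : NNReal) (B : ℝ), LipschitzWith L f → (∀ y, |f y| ≤ B) →
      ∫ y, f y ∂μ = ∫ y, f y ∂ν) : μ = ν := by
  let μ' : ProbabilityMeasure E := ⟨μ, inferInstance⟩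
  let ν' : ProbabilityMeasure E := ⟨ν, inferInstance⟩
  have ht : Filter.Tendsto (fun _ : ℕ => μ') Filter.atTop (nhds ν') := by
    rw [tendsto_iff_forall_lipschitz_integral_tendsto]
    rintro f ⟨C, hC⟩ ⟨L, hL⟩
    have := h f L (|f 0| + C) hL fun y => by
      have := hC y 0
      rw [Real.dist_eq] at this
      linarith [abs_sub_abs_le_abs_sub (f y) (f 0)]
    simp [μ', ν', this]
  have : μ' = ν' := tendsto_nhds_unique tendsto_const_nhds ht
  exact congrArg Subtype.val this

theorem integral_kernel_pow_succ' {α : Type*} [MeasurableSpace α] {Q : Kernel α α}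
    [IsMarkovKernel Q] (k : ℕ) (x : α) {f : α → ℝ} (hf : Measurable f) {B : ℝ}
    (hB : ∀ x, |f x| ≤ B) :
    ∫ y, f y ∂(Q ^ (k + 1)) x = ∫ z, ∫ y, f y ∂(Q z) ∂((Q ^ k) x) := by
  have hI : Integrable f ((Q ^ (k + 1)) x) := integrable_of_abs_le hf hB
  have : (Q ^ (k + 1)) x = ((Q ^ k) x).bind Q := by
    rw [pow_succ']; exact Kernel.comp_apply _ _ _
  rw [this] at hI ⊢
  exact integral_bind_kernel _ _ hI

/-- The mean of `Q^k f` under an invariant `π'` does not depend on `k`, while `Q^k f` converges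
pointwise and boundedly to the constant `∫ f dπ`. -/
theorem invariant_eq_of_tendsto {E : Type*} [NormedAddCommGroup E] [MeasurableSpace E]
    [BorelSpace E] {Q : Kernel E E} [IsMarkovKernel Q] {π : Measure E} [IsProbabilityMeasure π]
    (hπ : ∀ x (f : E → ℝ) (B : ℝ), Continuous f → (∀ y, |f y| ≤ B) →
      Filter.Tendsto (fun k => ∫ y, f y ∂(Q ^ k) x) Filter.atTop (nhds (∫ y, f y ∂π)))
    {π' : Measure E} [IsProbabilityMeasure π'] (hinv : Q.Invariant π') : π' = π := by
  refine measure_eq_of_forall_lipschitz_integral_eq fun f L B hf hB => ?_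
  have hm := hf.continuous.measurable
  have hk : ∀ k : ℕ, π'.bind (Q ^ k : Kernel E E) = π' := by
    intro k
    induction k with
    | zero => exact bind_kernel_pow_zero _ _
    | succ k ih => rw [bind_kernel_pow_succ, ih]; exact hinv
  have hc : ∀ k : ℕ, ∫ x, ∫ y, f y ∂(Q ^ k) x ∂π' = ∫ y, f y ∂π' := by
    intro k
    have hI : Integrable f (π'.bind (Q ^ k : Kernel E E)) := integrable_of_abs_le hm hB
    rw [← integral_bind_kernel _ _ hI, hk k]
  have hlim : Filter.Tendsto (fun k : ℕ => ∫ x, ∫ y, f y ∂(Q ^ k) x ∂π') Filter.atTop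
      (nhds (∫ _, ∫ y, f y ∂π ∂π')) := by
    refine tendsto_integral_of_dominated_convergence (fun _ => B) (fun k => ?_)
      (integrable_const _) (fun k => ae_of_all _ fun x => abs_integral_le_of_abs_le hB)
      (ae_of_all _ fun x => hπ x f B hf.continuous hB)
    exact (StronglyMeasurable.integral_kernel hm.stronglyMeasurable).aestronglyMeasurable
  simp_rw [hc] at hlim
  simpa using tendsto_nhds_unique tendsto_const_nhds hlim

variable {E : Type*} [NormedAddCommGroup E] [MeasurableSpace E] [BorelSpace E]
  [SecondCountableTopology E]
  {Q : Kernel E E} [IsMarkovKernel Q] {M ρ : ℝ}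

/-- Conditioning on the first step compares `Q^k f` at `0` with its mean under `Q(0, ·)`.
Boundedness of `f` is not asked for, so that `f` may be the norm. -/
theorem DiracContraction.abs_integral_pow_succ_sub_le (hQ : DiracContraction Q M ρ) (hM : 0 ≤ M)
    (hρ : 0 ≤ ρ) {f : E → ℝ} {L : NNReal} (hf : LipschitzWith L f)
    (hfi : ∀ k x, Integrable f ((Q ^ k) x)) (h1 : Integrable (fun y => ‖y‖) (Q 0)) (k : ℕ) :
    |∫ y, f y ∂(Q ^ (k + 1)) 0 - ∫ y, f y ∂(Q ^ k) 0|
      ≤ L * M * (∫ y, ‖y‖ ∂(Q 0)) * ρ ^ k := by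
  have hI := hfi (k + 1) 0
  rw [kernel_pow_succ_apply, ← Kernel.comp_apply] at hI
  have hin : Integrable (fun z => ∫ y, f y ∂(Q ^ k) z) (Q 0) := hI.integral_comp
  rw [kernel_pow_succ_apply, ← Kernel.comp_apply, Kernel.integral_comp hI]
  calc |∫ z, ∫ y, f y ∂(Q ^ k) z ∂(Q 0) - ∫ y, f y ∂(Q ^ k) 0|
      = |∫ z, (∫ y, f y ∂(Q ^ k) z - ∫ y, f y ∂(Q ^ k) 0) ∂(Q 0)| := by
        rw [integral_sub hin (integrable_const _)]; simp
    _ ≤ ∫ z, |∫ y, f y ∂(Q ^ k) z - ∫ y, f y ∂(Q ^ k) 0| ∂(Q 0) := abs_integral_le_integral_abs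
    _ ≤ ∫ z, L * (M * ρ ^ k * ‖z‖) ∂(Q 0) := by
        refine integral_mono (hin.sub (integrable_const _)).abs ((h1.const_mul _).const_mul _)
          fun z => ?_
        have := abs_integral_sub_le_of_lipschitz hf (hfi k 0) (hfi k z) (by positivity) (hQ k 0 z)
        simpa using this
    _ = _ := by rw [integral_const_mul, integral_const_mul]; ring

/-- The norm is `1`-Lipschitz, so the first moments form a Cauchy sequence. -/
theorem DiracContraction.exists_integral_norm_le (hQ : DiracContraction Q M ρ) (hM : 0 ≤ M)
    (hρ : 0 ≤ ρ) (hρ1 : ρ < 1) (h1 : ∀ k x, Integrable (fun y => ‖y‖) ((Q ^ k) x)) :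
    ∃ B, ∀ k, ∫ y, ‖y‖ ∂(Q ^ k) 0 ≤ B := by
  have h0 : Integrable (fun y => ‖y‖) (Q 0) := by simpa using h1 1 0
  have hc : CauchySeq fun k => ∫ y, ‖y‖ ∂(Q ^ k) 0 := by
    refine cauchySeq_of_le_geometric ρ (1 * M * (∫ y, ‖y‖ ∂(Q 0))) hρ1 fun k => ?_
    rw [dist_comm, Real.dist_eq]
    exact hQ.abs_integral_pow_succ_sub_le hM hρ (L := 1) lipschitzWith_one_norm h1 h0 k
  obtain ⟨B, hB⟩ := hc.isBounded_range.bddAbove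
  exact ⟨B, fun k => hB ⟨k, rfl⟩⟩

/-- A contracting Markov chain with integrable increments converges in law to a probability
measure that does not depend on the starting point. -/
theorem DiracContraction.exists_tendsto [ProperSpace E] (hQ : DiracContraction Q M ρ)
    (hM : 0 ≤ M) (hρ : 0 ≤ ρ) (hρ1 : ρ < 1)
    (h1 : ∀ k x, Integrable (fun y => ‖y‖) ((Q ^ k) x)) :
    ∃ π : Measure E, IsProbabilityMeasure π ∧ ∀ x (f : E → ℝ) (B : ℝ), Continuous f →
      (∀ y, |f y| ≤ B) →
      Filter.Tendsto (fun k => ∫ y, f y ∂(Q ^ k) x) Filter.atTop (nhds (∫ y, f y ∂π)) := by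
  let μ : E → ℕ → ProbabilityMeasure E := fun x k => ⟨(Q ^ k) x, inferInstance⟩
  obtain ⟨B, hB⟩ := hQ.exists_integral_norm_le hM hρ hρ1 h1
  -- Markov's inequality with the uniform first moment. Prokhorov then gives one subsequential limit
  -- `π`.
  have htight : IsTightMeasureSet
      {((ν : ProbabilityMeasure E) : Measure E) | ν ∈ Set.range (μ 0)} := by
    refine isTightMeasureSet_of_tendsto_measure_norm_gt ?_
    have hlim : Filter.Tendsto (fun r : ℝ => ENNReal.ofReal (B / r)) Filter.atTop (nhds 0) := by
      have : Filter.Tendsto (fun r : ℝ => B / r) Filter.atTop (nhds 0) :=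
        Filter.Tendsto.const_div_atTop Filter.tendsto_id B
      simpa using ENNReal.tendsto_ofReal this
    refine tendsto_of_tendsto_of_tendsto_of_le_of_le' tendsto_const_nhds hlim
      (Filter.Eventually.of_forall fun _ => zero_le) ?_
    filter_upwards [Filter.eventually_gt_atTop 0] with r hr
    refine iSup₂_le ?_
    rintro _ ⟨_, ⟨k, rfl⟩, rfl⟩
    change (Q ^ k) 0 {x | r < ‖x‖} ≤ _
    rw [← ofReal_measureReal]
    refine ENNReal.ofReal_le_ofReal ?_
    rw [le_div_iff₀ hr, mul_comm]
    refine le_trans ?_ ((mul_meas_ge_le_integral_of_nonneg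
      (ae_of_all _ fun y => norm_nonneg y) (h1 k 0) r).trans (hB k))
    exact mul_le_mul_of_nonneg_left
      (measureReal_mono fun y (hy : r < ‖y‖) => hy.le) hr.le
  obtain ⟨π, -, φ, hφ, hπ⟩ := (isCompact_closure_of_isTightMeasureSet htight).tendsto_subseq
    (x := μ 0) fun n => subset_closure ⟨n, rfl⟩
  have h0 : Integrable (fun y => ‖y‖) (Q 0) := by simpa using h1 1 0
  have hlim : ∀ x, Filter.Tendsto (μ x) Filter.atTop (nhds π) := by
    intro x
    rw [tendsto_iff_forall_lipschitz_integral_tendsto]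
    rintro f ⟨C, hC⟩ ⟨L, hL⟩
    have hfB : ∀ y, |f y| ≤ |f 0| + C := fun y => by
      have := hC y 0
      rw [Real.dist_eq] at this
      linarith [abs_sub_abs_le_abs_sub (f y) (f 0)]
    have hfi : ∀ k x, Integrable f ((Q ^ k) x) := fun k x =>
      integrable_of_abs_le hL.continuous.measurable hfB
    -- The Cauchy property extends convergence to the whole sequence started at `0`; contraction
    -- extends it to every starting point.
    have hc : CauchySeq fun k => ∫ y, f y ∂(Q ^ k) 0 := by
      refine cauchySeq_of_le_geometric ρ (L * M * (∫ y, ‖y‖ ∂(Q 0))) hρ1 fun k => ?_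
      rw [dist_comm, Real.dist_eq]
      exact hQ.abs_integral_pow_succ_sub_le hM hρ hL hfi h0 k
    obtain ⟨l, hl⟩ := cauchySeq_tendsto_of_complete hc
    have hsub := (tendsto_iff_forall_lipschitz_integral_tendsto.1 hπ) f ⟨C, hC⟩ ⟨L, hL⟩
    have hlπ : l = ∫ y, f y ∂(π : Measure E) :=
      tendsto_nhds_unique (hl.comp hφ.tendsto_atTop) hsub
    rw [← hlπ]
    have hdiff : Filter.Tendsto (fun k => ∫ y, f y ∂(Q ^ k) x - ∫ y, f y ∂(Q ^ k) 0)
        Filter.atTop (nhds 0) := by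
      have hg : Filter.Tendsto (fun k => L * (M * ρ ^ k * ‖x‖)) Filter.atTop (nhds 0) := by
        simpa using (((tendsto_pow_atTop_nhds_zero_of_lt_one hρ hρ1).const_mul M).mul_const
          ‖x‖).const_mul (L : ℝ)
      refine squeeze_zero_norm (fun k => ?_) hg
      have := abs_integral_sub_le_of_lipschitz hL (hfi k 0) (hfi k x) (by positivity) (hQ k 0 x)
      simpa using this
    have := hdiff.add hl
    simp only [sub_add_cancel, zero_add] at this
    exact this
  refine ⟨π, inferInstance, fun x f B hf hfB => ?_⟩
  exact ProbabilityMeasure.tendsto_iff_forall_integral_tendsto.1 (hlim x)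
    (BoundedContinuousFunction.ofNormedAddCommGroup f hf B hfB)

/-- Contraction makes `Q f` bounded Lipschitz, so `Q^k(Q f)` at `0` tends to `∫ Q f dπ`; being the
shifted sequence `Q^(k+1) f`, it also tends to `∫ f dπ`. -/
theorem DiracContraction.invariant_of_tendsto (hQ : DiracContraction Q M ρ) (hM : 0 ≤ M)
    (hρ : 0 ≤ ρ) {π : Measure E} [IsProbabilityMeasure π]
    (hπ : ∀ x (f : E → ℝ) (B : ℝ), Continuous f → (∀ y, |f y| ≤ B) →
      Filter.Tendsto (fun k => ∫ y, f y ∂(Q ^ k) x) Filter.atTop (nhds (∫ y, f y ∂π))) :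
    Q.Invariant π := by
  refine measure_eq_of_forall_lipschitz_integral_eq fun f L B hf hB => ?_
  have hm := hf.continuous.measurable
  rw [integral_bind_kernel _ _ (integrable_of_abs_le hm hB)]
  have hl : LipschitzWith (L * (M * ρ ^ 1).toNNReal) fun x => ∫ y, f y ∂(Q x) := by
    simpa using hQ.lipschitz hM hρ hf hB 1
  have h1 := hπ 0 (fun x => ∫ y, f y ∂(Q x)) B hl.continuous
    fun y => abs_integral_le_of_abs_le hB
  have h2 := (Filter.tendsto_add_atTop_iff_nat 1).2 (hπ 0 f B hf.continuous hB)
  simp_rw [integral_kernel_pow_succ' _ _ hm hB] at h2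
  exact tendsto_nhds_unique h1 h2

end Ergodic

/-! ### Moments from the Poincaré inequality -/

section Moments

variable {d : ℕ}

/-- This function replaces the norm in moment estimates: it is smooth, hence allowed in
`PoincareInequality`. -/
theorem lipschitzWith_sqrt_one_add_norm_sq (E : Type*) [NormedAddCommGroup E] :
    LipschitzWith 1 (fun x : E => √(1 + ‖x‖ ^ 2)) := by
  refine LipschitzWith.of_le_add fun x y => ?_
  have hy : ‖y‖ ≤ √(1 + ‖y‖ ^ 2) := Real.le_sqrt_of_sq_le (by linarith)
  have hsq : √(1 + ‖y‖ ^ 2) ^ 2 = 1 + ‖y‖ ^ 2 := Real.sq_sqrt (by positivity)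
  have hxy : ‖x‖ ≤ ‖y‖ + dist x y := by
    rw [dist_eq_norm]; exact norm_le_insert' x y
  refine Real.sqrt_le_iff.2 ⟨by positivity, ?_⟩
  nlinarith [norm_nonneg x, norm_nonneg y, dist_nonneg (x := x) (y := y),
    mul_le_mul_of_nonneg_right hy (dist_nonneg (x := x) (y := y)),
    pow_le_pow_left₀ (norm_nonneg x) hxy 2]

theorem contDiff_sqrt_one_add_norm_sq (E : Type*) [NormedAddCommGroup E] [InnerProductSpace ℝ E] :
    ContDiff ℝ ∞ (fun x : E => √(1 + ‖x‖ ^ 2)) :=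
  (contDiff_const.add (contDiff_norm_sq ℝ)).sqrt fun x => by positivity

theorem one_le_sqrt_one_add_norm_sq {E : Type*} [NormedAddCommGroup E] (x : E) :
    1 ≤ √(1 + ‖x‖ ^ 2) := Real.one_le_sqrt.2 (by nlinarith [norm_nonneg x])

theorem PoincareInequality.integrable_sqrt_pow {μ : Measure (EuclideanSpace ℝ (Fin d))} {C : ℝ}
    (h : PoincareInequality μ C) (n : ℕ) : Integrable (fun x => √(1 + ‖x‖ ^ 2) ^ n) μ := by
  refine (h _ ((contDiff_sqrt_one_add_norm_sq _).pow n) ⟨1, n, fun x => ?_⟩).1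
  rw [one_mul, abs_of_nonneg (by positivity)]
  exact pow_le_pow_left₀ (by positivity) (sqrt_one_add_norm_sq_le x) n

/-- Test the inequality on `u^(j+1)` with `u = √(1 + ‖x‖²)`: since `u` is `1`-Lipschitz, the
gradient is at most `(j+1) u^j`. -/
theorem PoincareInequality.integral_sqrt_pow_le {μ : Measure (EuclideanSpace ℝ (Fin d))} {C : ℝ}
    (hC : 0 ≤ C) (h : PoincareInequality μ C) (j : ℕ) :
    ∫ x, √(1 + ‖x‖ ^ 2) ^ (2 * (j + 1)) ∂μ
      ≤ (∫ x, √(1 + ‖x‖ ^ 2) ^ (j + 1) ∂μ) ^ 2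
        + C * ((j + 1) ^ 2 * ∫ x, √(1 + ‖x‖ ^ 2) ^ (2 * j) ∂μ) := by
  set u : EuclideanSpace ℝ (Fin d) → ℝ := fun x => √(1 + ‖x‖ ^ 2) with hu
  have hus := contDiff_sqrt_one_add_norm_sq (EuclideanSpace ℝ (Fin d))
  obtain ⟨-, -, h3⟩ := h (fun x => u x ^ (j + 1)) (hus.pow (j + 1)) ⟨1, j + 1, fun x => by
    rw [one_mul, abs_of_nonneg (by positivity)]
    exact pow_le_pow_left₀ (by positivity) (sqrt_one_add_norm_sq_le x) _⟩
  have hI := h.integrable_sqrt_pow (2 * j)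
  have hgrad : ∫⁻ x, ENNReal.ofReal (‖gradient (fun x => u x ^ (j + 1)) x‖ ^ 2) ∂μ
      ≤ ENNReal.ofReal ((j + 1) ^ 2 * ∫ x, u x ^ (2 * j) ∂μ) := by
    rw [← integral_const_mul, ofReal_integral_eq_lintegral_ofReal (hI.const_mul _)
      (ae_of_all _ fun _ => by positivity)]
    refine lintegral_mono fun x => ENNReal.ofReal_le_ofReal ?_
    rw [norm_gradient_eq_norm_fderiv,
      fderiv_fun_pow (j + 1) (hus.differentiable (by simp)).differentiableAt, norm_smul, mul_pow]
    have h1 : ‖fderiv ℝ u x‖ ≤ 1 := by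
      simpa using norm_fderiv_le_of_lipschitz ℝ (x₀ := x)
        (lipschitzWith_sqrt_one_add_norm_sq (EuclideanSpace ℝ (Fin d)))
    have h2 : ‖fderiv ℝ u x‖ ^ 2 ≤ 1 := pow_le_one₀ (norm_nonneg _) h1
    refine (mul_le_of_le_one_right (by positivity) h2).trans_eq ?_
    rw [Real.norm_of_nonneg (by positivity)]
    push_cast
    simp only [nsmul_eq_mul]
    push_cast
    ring
  have h4 := h3.trans (mul_le_mul_right hgrad _)
  rw [← ENNReal.ofReal_mul hC, ENNReal.ofReal_le_ofReal_iff (mul_nonneg hC (mul_nonneg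
    (by positivity) (integral_nonneg fun _ => by positivity)))] at h4
  have e : ∀ x, (u x ^ (j + 1)) ^ 2 = u x ^ (2 * (j + 1)) := fun x => by rw [← pow_mul, mul_comm]
  simp_rw [e] at h4
  linarith

/-- Induction on `j`: as `u ≥ 1`, the moment of order `j + 1` is at most that of order `2j` when `j
≥ 1`; for `j = 0` it is the first moment. `B'` is the same for all `μ`. -/
theorem exists_moment_bound_of_poincareInequality {C : ℝ} (hC : 0 ≤ C) (B : ℝ) (j : ℕ) :
    ∃ B' : ℝ, ∀ μ : Measure (EuclideanSpace ℝ (Fin d)), IsProbabilityMeasure μ →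
      PoincareInequality μ C → ∫ x, √(1 + ‖x‖ ^ 2) ∂μ ≤ B →
        ∫ x, √(1 + ‖x‖ ^ 2) ^ (2 * j) ∂μ ≤ B' := by
  induction j with
  | zero => exact ⟨1, fun μ _ _ _ => by simp⟩
  | succ j ih =>
    obtain ⟨B₁, hB₁⟩ := ih
    refine ⟨(max B B₁) ^ 2 + C * ((j + 1) ^ 2 * B₁), fun μ _ hμ hB => ?_⟩
    have h1 := hB₁ μ inferInstance hμ hB
    have h2 : ∫ x, √(1 + ‖x‖ ^ 2) ^ (j + 1) ∂μ ≤ max B B₁ := by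
      rcases Nat.eq_zero_or_pos j with rfl | hj
      · simpa using Or.inl hB
      · refine le_max_of_le_right (le_trans ?_ h1)
        refine integral_mono (hμ.integrable_sqrt_pow _) (hμ.integrable_sqrt_pow _) fun x => ?_
        exact pow_le_pow_right₀ (one_le_sqrt_one_add_norm_sq x) (by omega)
    have h0 : 0 ≤ ∫ x, √(1 + ‖x‖ ^ 2) ^ (j + 1) ∂μ := integral_nonneg fun _ => by positivity
    refine (hμ.integral_sqrt_pow_le hC j).trans ?_
    gcongr

/-- Weak convergence only sees bounded functions: the uniform moments are truncated by `χ n`, passed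
to the limit in `k`, and recovered by Fatou in `n`. -/
theorem integrable_one_add_norm_pow_of_tendsto {μ : ℕ → Measure (EuclideanSpace ℝ (Fin d))}
    {π : Measure (EuclideanSpace ℝ (Fin d))} [∀ k, IsProbabilityMeasure (μ k)]
    [IsProbabilityMeasure π]
    (hlim : ∀ (f : EuclideanSpace ℝ (Fin d) → ℝ) (B : ℝ), Continuous f → (∀ y, |f y| ≤ B) →
      Filter.Tendsto (fun k => ∫ y, f y ∂(μ k)) Filter.atTop (nhds (∫ y, f y ∂π)))
    {C : ℝ} (hC : 0 ≤ C) (hμ : ∀ k, PoincareInequality (μ k) C) {B : ℝ}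
    (hB : ∀ k, ∫ x, ‖x‖ ∂(μ k) ≤ B) (m : ℕ) : Integrable (fun x => (1 + ‖x‖) ^ m) π := by
  have hnorm : ∀ k, Integrable (fun x => ‖x‖) (μ k) := fun k => by
    refine ((hμ k).integrable_sqrt_pow 1).mono' (by fun_prop) (ae_of_all _ fun x => ?_)
    rw [norm_norm, pow_one]
    exact Real.le_sqrt_of_sq_le (by linarith)
  obtain ⟨B', hB'⟩ := exists_moment_bound_of_poincareInequality (d := d) hC (1 + B) m
  have hbd : ∀ k, ∫ x, √(1 + ‖x‖ ^ 2) ^ (2 * m) ∂(μ k) ≤ B' := fun k => by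
    refine hB' (μ k) inferInstance (hμ k) ?_
    calc ∫ x, √(1 + ‖x‖ ^ 2) ∂(μ k) ≤ ∫ x, (1 + ‖x‖) ∂(μ k) :=
          integral_mono (by simpa using (hμ k).integrable_sqrt_pow 1)
            ((integrable_const _).add (hnorm k)) sqrt_one_add_norm_sq_le
      _ ≤ 1 + B := by
          rw [integral_add (integrable_const _) (hnorm k)]
          simpa using hB k
  obtain ⟨χ, K, hχ, hχc, hχ0, hχ1, hχone, -⟩ :=
    exists_smooth_cutoff (EuclideanSpace ℝ (Fin d))
  have hus := (contDiff_sqrt_one_add_norm_sq (EuclideanSpace ℝ (Fin d))).continuous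
  have hle : ∀ n, ∫ x, χ n x * √(1 + ‖x‖ ^ 2) ^ (2 * m) ∂π ≤ B' := fun n => by
    have hc : Continuous fun x => χ n x * √(1 + ‖x‖ ^ 2) ^ (2 * m) :=
      (hχ n).continuous.mul (hus.pow _)
    obtain ⟨D, hD⟩ := hc.bounded_above_of_compact_support (hχc n).mul_right
    refine le_of_tendsto (hlim _ D hc hD) (Filter.Eventually.of_forall fun k => ?_)
    refine le_trans (integral_mono (integrable_of_abs_le hc.measurable hD)
      ((hμ k).integrable_sqrt_pow _) fun x => ?_) (hbd k)
    exact mul_le_of_le_one_left (by positivity) (hχ1 n x)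
  have hfin : ∫⁻ x, ENNReal.ofReal (√(1 + ‖x‖ ^ 2) ^ (2 * m)) ∂π ≤ ENNReal.ofReal B' := by
    have hpt : ∀ x : EuclideanSpace ℝ (Fin d), ENNReal.ofReal (√(1 + ‖x‖ ^ 2) ^ (2 * m))
        = Filter.liminf (fun n => ENNReal.ofReal (χ n x * √(1 + ‖x‖ ^ 2) ^ (2 * m)))
          Filter.atTop := by
      intro x
      refine (Filter.Tendsto.liminf_eq (tendsto_const_nhds.congr' ?_)).symm
      obtain ⟨N, hN⟩ := exists_nat_gt ‖x‖
      filter_upwards [Filter.eventually_ge_atTop N] with n hn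
      have : (N : ℝ) ≤ n := by exact_mod_cast hn
      rw [hχone n x (by linarith), one_mul]
    simp_rw [hpt]
    refine (lintegral_liminf_le fun n => ?_).trans ?_
    · exact ((hχ n).continuous.mul (hus.pow _)).measurable.ennreal_ofReal
    · refine Filter.liminf_le_of_frequently_le' (Filter.Frequently.of_forall fun n => ?_)
      have hc : Continuous fun x => χ n x * √(1 + ‖x‖ ^ 2) ^ (2 * m) :=
        (hχ n).continuous.mul (hus.pow _)
      obtain ⟨D, hD⟩ := hc.bounded_above_of_compact_support (hχc n).mul_right
      rw [← ofReal_integral_eq_lintegral_ofReal (integrable_of_abs_le hc.measurable hD)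
        (ae_of_all _ fun x => mul_nonneg (hχ0 n x) (by positivity))]
      exact ENNReal.ofReal_le_ofReal (hle n)
  have hint : Integrable (fun x => √(1 + ‖x‖ ^ 2) ^ (2 * m)) π := by
    refine ⟨by fun_prop, ?_⟩
    rw [hasFiniteIntegral_iff_ofReal (ae_of_all _ fun _ => by positivity)]
    exact hfin.trans_lt ENNReal.ofReal_lt_top
  refine (hint.const_mul (2 ^ m)).mono' (by fun_prop) (ae_of_all _ fun x => ?_)
  rw [Real.norm_of_nonneg (by positivity), pow_mul, ← mul_pow]
  refine pow_le_pow_left₀ (by positivity) ?_ m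
  rw [Real.sq_sqrt (by positivity)]
  nlinarith [sq_nonneg (‖x‖ - 1), sq_nonneg ‖x‖]

end Moments

/-! ### Gaussian test functions -/

/-- Completing the square: `t²/2 + l(m + σt)² = (A/2)(t + 2lσm/A)² + lm²/A` with `A = 1 + 2lσ²`. -/
theorem integral_exp_neg_mul_sq_gaussianReal {l : ℝ} (hl : 0 ≤ l) (m σ : ℝ) :
    ∫ t, Real.exp (-l * (m + σ * t) ^ 2) ∂(gaussianReal 0 1)
      = (√(1 + 2 * l * σ ^ 2))⁻¹ * Real.exp (-l * m ^ 2 / (1 + 2 * l * σ ^ 2)) := by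
  set A := 1 + 2 * l * σ ^ 2 with hA
  have hA0 : 0 < A := by positivity
  rw [integral_gaussianReal_eq_integral_smul one_ne_zero]
  have hpt : ∀ t : ℝ, gaussianPDFReal 0 1 t • Real.exp (-l * (m + σ * t) ^ 2)
      = ((√(2 * Real.pi))⁻¹ * Real.exp (-l * m ^ 2 / A))
        * Real.exp (-(A / 2) * (t + 2 * l * σ * m / A) ^ 2) := by
    intro t
    rw [gaussianPDFReal, smul_eq_mul]
    simp only [NNReal.coe_one, mul_one, sub_zero]
    rw [mul_assoc, mul_assoc, ← Real.exp_add, ← Real.exp_add]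
    congr 2
    field_simp
    rw [hA]
    ring
  simp_rw [hpt]
  rw [integral_const_mul, integral_add_right_eq_self (fun t => Real.exp (-(A / 2) * t ^ 2)),
    integral_gaussian, show Real.pi / (A / 2) = 2 * Real.pi / A by field_simp,
    Real.sqrt_div (by positivity)]
  have : √(2 * Real.pi) ≠ 0 := by positivity
  field_simp

theorem integral_exp_neg_mul_norm_sq_stdGaussian_le {d : ℕ} (hd : 1 ≤ d) {l : ℝ} (hl : 0 ≤ l)
    (m : EuclideanSpace ℝ (Fin d)) (σ : ℝ) :
    ∫ z, Real.exp (-l * ‖m + σ • z‖ ^ 2) ∂(stdGaussian (EuclideanSpace ℝ (Fin d)))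
      ≤ (√(1 + 2 * l * σ ^ 2))⁻¹ * Real.exp (-l * ‖m‖ ^ 2 / (1 + 2 * l * σ ^ 2)) := by
  set A := 1 + 2 * l * σ ^ 2 with hA
  have hA1 : 1 ≤ A := by
    have : 0 ≤ 2 * l * σ ^ 2 := by positivity
    linarith
  rw [← map_pi_eq_stdGaussian, integral_map (by fun_prop)
    (by fun_prop : Continuous fun z : EuclideanSpace ℝ (Fin d) =>
      Real.exp (-l * ‖m + σ • z‖ ^ 2)).aestronglyMeasurable]
  have hpt : ∀ x : Fin d → ℝ, Real.exp (-l * ‖m + σ • WithLp.toLp 2 x‖ ^ 2)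
      = ∏ i, Real.exp (-l * (m i + σ * x i) ^ 2) := by
    intro x
    rw [EuclideanSpace.real_norm_sq_eq, Finset.mul_sum, Real.exp_sum]
    simp
  simp_rw [hpt]
  rw [integral_fintype_prod_eq_prod (fun i t => Real.exp (-l * (m i + σ * t) ^ 2))]
  simp_rw [integral_exp_neg_mul_sq_gaussianReal hl]
  rw [Finset.prod_mul_distrib, ← Real.exp_sum, ← Finset.sum_div, ← Finset.mul_sum,
    ← EuclideanSpace.real_norm_sq_eq, Finset.prod_const, Finset.card_univ, Fintype.card_fin, ← hA]
  refine mul_le_mul_of_nonneg_right ?_ (Real.exp_pos _).le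
  -- Coordinates contribute `d` factors `(√A)⁻¹ ≤ 1`; one is kept, as `d ≥ 1`.
  exact pow_le_of_le_one (by positivity)
    (inv_le_one_of_one_le₀ (Real.one_le_sqrt.2 hA1)) (by omega)

/-! ### Escape of the Euler chain from a ball -/

section Euler

variable {d : ℕ} {b : EuclideanSpace ℝ (Fin d) → EuclideanSpace ℝ (Fin d)} {δ T : ℝ}

theorem norm_sq_euler_step_ge {Lb : ℝ} (hLip : ∀ x y, ‖b x - b y‖ ≤ Lb * ‖x - y‖)
    (hδ : 0 ≤ δ) (x : EuclideanSpace ℝ (Fin d)) :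
    (1 - δ * (2 * Lb + 1)) * ‖x‖ ^ 2 - δ * ‖b 0‖ ^ 2 ≤ ‖x + δ • b x‖ ^ 2 := by
  have hbx : ‖b x‖ ≤ ‖b 0‖ + Lb * ‖x‖ := by
    have := hLip x 0
    rw [sub_zero] at this
    linarith [norm_le_insert' (b x) (b 0)]
  have h1 : ‖x‖ - δ * ‖b x‖ ≤ ‖x + δ • b x‖ := by
    have := norm_sub_le_norm_add x (δ • b x)
    rwa [norm_smul, Real.norm_of_nonneg hδ] at this
  have h2 : ‖x + δ • b x‖ ^ 2 = ‖x‖ ^ 2 + 2 * (δ * inner ℝ x (b x)) + (δ * ‖b x‖) ^ 2 := by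
    rw [norm_add_sq_real, inner_smul_right, norm_smul, Real.norm_of_nonneg hδ]
  have h3 : -(‖x‖ * ‖b x‖) ≤ inner ℝ x (b x) := neg_le_of_abs_le (abs_real_inner_le_norm _ _)
  have h4 : ‖x‖ * ‖b x‖ ≤ ‖x‖ * (‖b 0‖ + Lb * ‖x‖) := mul_le_mul_of_nonneg_left hbx (norm_nonneg _)
  have h5 : -(2 * (‖x‖ * ‖b 0‖) + 2 * (Lb * ‖x‖ ^ 2)) ≤ 2 * inner ℝ x (b x) := by nlinarith
  have h6 : 2 * (‖x‖ * ‖b 0‖) ≤ ‖x‖ ^ 2 + ‖b 0‖ ^ 2 := by nlinarith [sq_nonneg (‖x‖ - ‖b 0‖)]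
  have h7 : -(‖x‖ ^ 2 + ‖b 0‖ ^ 2 + 2 * (Lb * ‖x‖ ^ 2)) ≤ 2 * inner ℝ x (b x) := by linarith
  have h8 := mul_le_mul_of_nonneg_left h7 hδ
  rw [h2]
  nlinarith [sq_nonneg (δ * ‖b x‖)]

theorem integral_exp_neg_mul_norm_sq_eulerKernel_le (hd : 1 ≤ d) (hb : Measurable b)
    (hδ : 0 ≤ δ) (hT : 0 ≤ T) {l : ℝ} (hl : 0 ≤ l) (x : EuclideanSpace ℝ (Fin d)) :
    ∫ y, Real.exp (-l * ‖y‖ ^ 2) ∂(eulerKernel b δ T x)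
      ≤ (√(1 + 4 * l * T * δ))⁻¹ * Real.exp (-l * ‖x + δ • b x‖ ^ 2 / (1 + 4 * l * T * δ)) := by
  rw [integral_eulerKernel hb x (by fun_prop)]
  refine (integral_exp_neg_mul_norm_sq_stdGaussian_le hd hl (x + δ • b x) _).trans_eq ?_
  rw [Real.sq_sqrt (by positivity), show 1 + 2 * l * (2 * T * δ) = 1 + 4 * l * T * δ by ring]

/-- Iterating the Euler kernel on a Gaussian test function spreads it out. -/
theorem exists_integral_exp_eulerKernel_pow_le (hd : 1 ≤ d) {Lb : ℝ}
    (hLip : ∀ x y, ‖b x - b y‖ ≤ Lb * ‖x - y‖) (hLb : 0 ≤ Lb) (hb : Measurable b)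
    (hδ : 0 ≤ δ) (hq : 0 < 1 - δ * (2 * Lb + 1)) (hT : 0 ≤ T) {l : ℝ} (hl : 0 < l) (k : ℕ) :
    ∃ l' : ℝ, 0 < l' ∧ l' * (1 + 4 * T * δ * k * l) ≤ l ∧ ∀ x,
      ∫ y, Real.exp (-l * ‖y‖ ^ 2) ∂((eulerKernel b δ T ^ k) x)
        ≤ √(l' / l) * (Real.exp (δ * ‖b 0‖ ^ 2 * l) / √(1 - δ * (2 * Lb + 1))) ^ k
          * Real.exp (-l' * ‖x‖ ^ 2) := by
  have := isMarkovKernel_eulerKernel hb δ T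
  set q := 1 - δ * (2 * Lb + 1) with hqdef
  have hq1 : q ≤ 1 := by
    have : 0 ≤ δ * (2 * Lb + 1) := by positivity
    linarith
  set D := Real.exp (δ * ‖b 0‖ ^ 2 * l) / √q with hD
  have hexp1 : ∀ l' : ℝ, 0 ≤ l' → ∀ y : EuclideanSpace ℝ (Fin d),
      |Real.exp (-l' * ‖y‖ ^ 2)| ≤ 1 := fun l' hl' y => by
    rw [abs_of_pos (Real.exp_pos _), Real.exp_le_one_iff, neg_mul, neg_nonpos]
    positivity
  induction k with
  | zero =>
    refine ⟨l, hl, by simp, fun x => ?_⟩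
    rw [kernel_pow_zero_apply, integral_dirac' _ _ (by fun_prop : Continuous fun
      y : EuclideanSpace ℝ (Fin d) => Real.exp (-l * ‖y‖ ^ 2)).stronglyMeasurable]
    simp [div_self hl.ne']
  | succ k ih =>
    obtain ⟨l₁, hl₁, hl₁l, hint⟩ := ih
    set A := 1 + 4 * l₁ * T * δ with hA
    have hA1 : 1 ≤ A := by
      have : 0 ≤ 4 * l₁ * T * δ := by positivity
      linarith
    have hA0 : 0 < A := by linarith
    have hl₁le : l₁ ≤ l := by
      refine le_trans ?_ hl₁l
      refine le_mul_of_one_le_right hl₁.le ?_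
      have : 0 ≤ 4 * T * δ * k * l := by positivity
      linarith
    -- As `q ≤ 1`, the new exponent satisfies `1/l' ≥ 1/l₁ + 4Tδ`: inverse widths grow at least
    -- linearly in `k`.
    refine ⟨l₁ * q / A, by positivity, ?_, fun x => ?_⟩
    · rw [div_mul_eq_mul_div, div_le_iff₀ hA0]
      have hX : 0 ≤ 1 + 4 * T * δ * (k + 1 : ℕ) * l := by positivity
      calc l₁ * q * (1 + 4 * T * δ * (k + 1 : ℕ) * l)
          ≤ l₁ * 1 * (1 + 4 * T * δ * (k + 1 : ℕ) * l) := by gcongr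
        _ = l₁ * (1 + 4 * T * δ * k * l) + 4 * T * δ * l * l₁ := by push_cast; ring
        _ ≤ l + 4 * T * δ * l * l₁ := by linarith
        _ = l * A := by rw [hA]; ring
    · rw [integral_kernel_pow_succ _ k x (by fun_prop) (hexp1 l hl.le)]
      have hD0 : 0 ≤ D := by positivity
      calc ∫ z, ∫ y, Real.exp (-l * ‖y‖ ^ 2) ∂((eulerKernel b δ T ^ k) z) ∂(eulerKernel b δ T x)
          ≤ ∫ z, √(l₁ / l) * D ^ k * Real.exp (-l₁ * ‖z‖ ^ 2) ∂(eulerKernel b δ T x) := by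
            refine integral_mono (integrable_of_abs_le
              (StronglyMeasurable.integral_kernel (by fun_prop : Continuous fun
                y : EuclideanSpace ℝ (Fin d) =>
                  Real.exp (-l * ‖y‖ ^ 2)).stronglyMeasurable).measurable
              fun z => abs_integral_le_of_abs_le (hexp1 l hl.le))
              ((integrable_of_abs_le (by fun_prop) (hexp1 l₁ hl₁.le)).const_mul _) hint
        _ ≤ √(l₁ / l) * D ^ k * ((√A)⁻¹ * Real.exp (-l₁ * ‖x + δ • b x‖ ^ 2 / A)) := by
            rw [integral_const_mul]
            gcongr
            exact integral_exp_neg_mul_norm_sq_eulerKernel_le hd hb hδ hT hl₁.le x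
        _ ≤ √(l₁ / l) * D ^ k * ((√A)⁻¹ * (Real.exp (δ * ‖b 0‖ ^ 2 * l)
              * Real.exp (-(l₁ * q / A) * ‖x‖ ^ 2))) := by
            gcongr
            rw [← Real.exp_add, Real.exp_le_exp]
            have hstep := mul_le_mul_of_nonneg_left (norm_sq_euler_step_ge hLip hδ x) hl₁.le
            rw [← hqdef] at hstep
            rw [div_le_iff₀ hA0]
            have e : (δ * ‖b 0‖ ^ 2 * l + -(l₁ * q / A) * ‖x‖ ^ 2) * A
                = δ * ‖b 0‖ ^ 2 * l * A - l₁ * q * ‖x‖ ^ 2 := by field_simp; ring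
            rw [e]
            have h0 : 0 ≤ δ * ‖b 0‖ ^ 2 := by positivity
            have h1 : δ * ‖b 0‖ ^ 2 * l₁ ≤ δ * ‖b 0‖ ^ 2 * l * A := by
              calc δ * ‖b 0‖ ^ 2 * l₁ ≤ δ * ‖b 0‖ ^ 2 * l := by gcongr
                _ ≤ _ := le_mul_of_one_le_right (by positivity) hA1
            nlinarith
        _ = _ := by
            -- The prefactors telescope to `√(l'/l)`, each step leaving a factor `1/√q`, which `D`
            -- contains.
            have e : √(l₁ * q / A / l) = √(l₁ / l) * (√A)⁻¹ * √q := by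
              rw [← Real.sqrt_inv, ← Real.sqrt_mul (by positivity),
                ← Real.sqrt_mul (by positivity)]
              congr 1
              field_simp
            rw [e, pow_succ D]
            have hsq : √q ≠ 0 := by positivity
            have : D * √q = Real.exp (δ * ‖b 0‖ ^ 2 * l) := by rw [hD]; field_simp
            rw [← this]
            ring

theorem inv_sqrt_one_sub_le_exp {y : ℝ} (h0 : 0 ≤ y) (h1 : y ≤ 1 / 2) :
    (√(1 - y))⁻¹ ≤ Real.exp y := by
  rw [← Real.sqrt_inv]
  refine Real.sqrt_le_iff.2 ⟨(Real.exp_pos _).le, ?_⟩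
  rw [← Real.exp_nat_mul, inv_le_iff_one_le_mul₀ (by linarith)]
  have := Real.add_one_le_exp ((2 : ℕ) * y)
  push_cast at this ⊢
  nlinarith

/-- At high temperature the chain leaves a given ball with high probability after a fixed
physical time, uniformly in the step size and the starting point. -/
theorem exists_integral_indicator_ball_eulerKernel_pow_le (hd : 1 ≤ d) {Lb : ℝ}
    (hLip : ∀ x y, ‖b x - b y‖ ≤ Lb * ‖x - y‖) (hLb : 0 ≤ Lb) (hb : Measurable b) {R : ℝ}
    (hR : 0 < R) {t ε : ℝ} (ht : 0 < t) (hε : 0 < ε) :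
    ∃ T₀ : ℝ, 0 < T₀ ∧ ∀ δ T : ℝ, 0 < δ → δ * (2 * Lb + 1) ≤ 1 / 2 → T₀ ≤ T → ∀ k : ℕ,
      t ≤ k * δ → k * δ ≤ 2 * t → ∀ x,
        ∫ y, (Metric.ball 0 R).indicator (fun _ => (1 : ℝ)) y ∂((eulerKernel b δ T ^ k) x)
          ≤ ε := by
  -- With this width, `exp 1 * exp (-l‖y‖²) ≥ 1` on the ball.
  set l := (R ^ 2)⁻¹ with hl
  have hl0 : 0 < l := by positivity
  set κ := ‖b 0‖ ^ 2 * l + (2 * Lb + 1) with hκ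
  have hκ0 : 0 ≤ κ := by positivity
  set Z := Real.exp 1 * Real.exp (2 * t * κ) with hZ
  have hZ0 : 0 < Z := by positivity
  -- Since `kδ ≥ t`, this choice gives `1 + 4Tδkl ≥ (Z/ε)²`, hence `√(l'/l) ≤ ε/Z`. The accumulated
  -- loss `D^k` is at most `exp(kδκ) ≤ exp(2tκ)`, uniformly in `δ`.
  refine ⟨(Z / ε) ^ 2 / (4 * t * l), by positivity, fun δ T hδ hδL hT k hk1 hk2 x => ?_⟩
  have := isMarkovKernel_eulerKernel hb δ T
  have hT0 : 0 < T := lt_of_lt_of_le (by positivity) hT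
  obtain ⟨l', hl'0, hl'l, hint⟩ := exists_integral_exp_eulerKernel_pow_le hd hLip hLb hb hδ.le
    (by linarith) hT0.le hl0 k
  have hratio : l' / l ≤ (ε / Z) ^ 2 := by
    rw [div_le_iff₀ (by positivity)] at hT
    have h1 : (Z / ε) ^ 2 ≤ 1 + 4 * T * δ * k * l := by
      calc (Z / ε) ^ 2 ≤ T * (4 * t * l) := hT
        _ ≤ T * (4 * (k * δ) * l) := by gcongr
        _ ≤ _ := by linarith
    rw [div_le_iff₀ hl0, ← one_div_div, one_div_pow, div_mul_eq_mul_div, one_mul,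
      le_div_iff₀ (by positivity)]
    exact (mul_le_mul_of_nonneg_left h1 hl'0.le).trans hl'l
  have hD : (Real.exp (δ * ‖b 0‖ ^ 2 * l) / √(1 - δ * (2 * Lb + 1))) ^ k
      ≤ Real.exp (2 * t * κ) := by
    have h1 : Real.exp (δ * ‖b 0‖ ^ 2 * l) / √(1 - δ * (2 * Lb + 1)) ≤ Real.exp (δ * κ) := by
      rw [div_eq_mul_inv, show δ * κ = δ * ‖b 0‖ ^ 2 * l + δ * (2 * Lb + 1) by rw [hκ]; ring,
        Real.exp_add]
      gcongr
      exact inv_sqrt_one_sub_le_exp (by positivity) hδL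
    calc _ ≤ Real.exp (δ * κ) ^ k := by gcongr
      _ = Real.exp (k * δ * κ) := by rw [← Real.exp_nat_mul, mul_assoc]
      _ ≤ _ := by gcongr
  have hexp1 : ∀ y : EuclideanSpace ℝ (Fin d), |Real.exp (-l * ‖y‖ ^ 2)| ≤ 1 := fun y => by
    rw [abs_of_pos (Real.exp_pos _), Real.exp_le_one_iff, neg_mul, neg_nonpos]
    positivity
  calc ∫ y, (Metric.ball 0 R).indicator (fun _ => (1 : ℝ)) y ∂((eulerKernel b δ T ^ k) x)
      ≤ ∫ y, Real.exp 1 * Real.exp (-l * ‖y‖ ^ 2) ∂((eulerKernel b δ T ^ k) x) := by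
        refine integral_mono ((integrable_const 1).indicator measurableSet_ball)
          ((integrable_of_abs_le (by fun_prop) hexp1).const_mul _) fun y => ?_
        refine Set.indicator_apply_le' (fun hy => ?_) fun _ => by positivity
        rw [← Real.exp_add]
        refine Real.one_le_exp ?_
        rw [mem_ball_zero_iff] at hy
        have : l * ‖y‖ ^ 2 ≤ 1 := by
          rw [hl, inv_mul_le_iff₀ (by positivity), mul_one]
          exact pow_le_pow_left₀ (norm_nonneg _) hy.le 2
        linarith
    _ ≤ Real.exp 1 * ((ε / Z) * Real.exp (2 * t * κ) * 1) := by
        rw [integral_const_mul]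
        refine mul_le_mul_of_nonneg_left ((hint x).trans ?_) (Real.exp_pos _).le
        gcongr
        · exact Real.sqrt_le_iff.2 ⟨by positivity, hratio⟩
        · exact (le_abs_self _).trans (by
            rw [abs_of_pos (Real.exp_pos _), Real.exp_le_one_iff, neg_mul, neg_nonpos]
            positivity)
    _ = ε := by rw [hZ]; field_simp

end Euler

/-! ### Synchronous coupling -/

section Coupling

variable {d : ℕ} {b : EuclideanSpace ℝ (Fin d) → EuclideanSpace ℝ (Fin d)} {δ T : ℝ}

theorem bind_eulerKernel_eq_map (hb : Measurable b) (δ T : ℝ)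
    {α : Type*} [MeasurableSpace α] (π : Measure α) [SFinite π]
    {p : α → EuclideanSpace ℝ (Fin d)} (hp : Measurable p) :
    (π.map p).bind (eulerKernel b δ T)
      = (π.prod (stdGaussian (EuclideanSpace ℝ (Fin d)))).map
        (fun w => p w.1 + δ • b (p w.1) + √(2 * T * δ) • w.2) := by
  have hm : Measurable (fun w : α × EuclideanSpace ℝ (Fin d) =>
      p w.1 + δ • b (p w.1) + √(2 * T * δ) • w.2) := by fun_prop
  ext s hs
  rw [Measure.bind_apply hs (Kernel.aemeasurable _), lintegral_map (Kernel.measurable_coe _ hs) hp,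
    Measure.map_apply hm hs, Measure.prod_apply (hm hs)]
  refine lintegral_congr fun a => ?_
  rw [eulerKernel_apply hb, Measure.map_apply (by fun_prop) hs]
  rfl

/-- One step of the synchronous coupling. -/
theorem exists_synchronous_coupling (hb : Measurable b) (δ T : ℝ)
    (π : Measure (EuclideanSpace ℝ (Fin d) × EuclideanSpace ℝ (Fin d))) [SFinite π] :
    ∃ π' : Measure (EuclideanSpace ℝ (Fin d) × EuclideanSpace ℝ (Fin d)),
      π'.fst = π.fst.bind (eulerKernel b δ T) ∧ π'.snd = π.snd.bind (eulerKernel b δ T) ∧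
      ∀ w : EuclideanSpace ℝ (Fin d) → ℝ≥0∞, Measurable w →
        ∫⁻ z, w z.1 * edist z.1 z.2 ^ 2 ∂π'
          = ∫⁻ z, (∫⁻ y, w y ∂(eulerKernel b δ T z.1))
              * edist (z.1 + δ • b z.1) (z.2 + δ • b z.2) ^ 2 ∂π := by
  set γ := stdGaussian (EuclideanSpace ℝ (Fin d))
  set σ := √(2 * T * δ) with hσ
  let Φ : (EuclideanSpace ℝ (Fin d) × EuclideanSpace ℝ (Fin d)) × EuclideanSpace ℝ (Fin d)
      → EuclideanSpace ℝ (Fin d) × EuclideanSpace ℝ (Fin d) :=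
    fun q => (q.1.1 + δ • b q.1.1 + σ • q.2, q.1.2 + δ • b q.1.2 + σ • q.2)
  have hΦ : Measurable Φ := by fun_prop
  refine ⟨(π.prod γ).map Φ, ?_, ?_, fun w hw => ?_⟩
  · rw [Measure.fst, Measure.fst, bind_eulerKernel_eq_map hb δ T π measurable_fst,
      Measure.map_map measurable_fst hΦ]
    rfl
  · rw [Measure.snd, Measure.snd, bind_eulerKernel_eq_map hb δ T π measurable_snd,
      Measure.map_map measurable_snd hΦ]
    rfl
  · rw [lintegral_map (by fun_prop) hΦ, lintegral_prod _ (by fun_prop)]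
    refine lintegral_congr fun z => ?_
    rw [lintegral_eulerKernel hb z.1 hw, ← lintegral_mul_const _ (by fun_prop)]
    refine lintegral_congr fun y => ?_
    -- The common noise cancels in the distance, so only the weight is averaged.
    simp only [Φ, edist_add_right]
    rfl

/-- A weight `w` for which `w(x) |x - y|²` contracts along the synchronous coupling yields a
Wasserstein contraction. -/
theorem wasserstein2_bind_eulerKernel_pow_le (hb : Measurable b) {w : EuclideanSpace ℝ (Fin d) → ℝ}
    (hw : Measurable w) {M ρ : ℝ} (hM : 0 < M) (hρ : 0 < ρ) (hw1 : ∀ x, 1 ≤ w x)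
    (hwM : ∀ x, w x ≤ M ^ 2)
    (hc : ∀ x y, (∫ z, w z ∂(eulerKernel b δ T x)) * ‖x + δ • b x - (y + δ • b y)‖ ^ 2
      ≤ ρ ^ 2 * (w x * ‖x - y‖ ^ 2))
    (k : ℕ) (μ ν : Measure (EuclideanSpace ℝ (Fin d))) [IsProbabilityMeasure μ] :
    wasserstein2
        (μ.bind (eulerKernel b δ T ^ k : Kernel (EuclideanSpace ℝ (Fin d)) _))
        (ν.bind (eulerKernel b δ T ^ k : Kernel (EuclideanSpace ℝ (Fin d)) _))
      ≤ ENNReal.ofReal (M * ρ ^ k) * wasserstein2 μ ν := by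
  have := isMarkovKernel_eulerKernel hb δ T
  have hsq : ∀ x y : EuclideanSpace ℝ (Fin d), edist x y ^ 2 = ENNReal.ofReal (‖x - y‖ ^ 2) :=
    fun x y => by rw [edist_dist, dist_eq_norm, ENNReal.ofReal_pow (norm_nonneg _)]
  have hwi : ∀ x, Integrable w (eulerKernel b δ T x) := fun x =>
    integrable_of_abs_le hw (B := M ^ 2) fun y => by
      rw [abs_of_nonneg (by linarith [hw1 y])]; exact hwM y
  have hW : Measurable fun x => ENNReal.ofReal (w x) := hw.ennreal_ofReal
  have hstep : ∀ (k : ℕ) (π : Measure (EuclideanSpace ℝ (Fin d) × EuclideanSpace ℝ (Fin d))),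
      π.fst = μ → π.snd = ν →
      ∃ π' : Measure (EuclideanSpace ℝ (Fin d) × EuclideanSpace ℝ (Fin d)),
        π'.fst = μ.bind (eulerKernel b δ T ^ k : Kernel (EuclideanSpace ℝ (Fin d)) _) ∧
        π'.snd = ν.bind (eulerKernel b δ T ^ k : Kernel (EuclideanSpace ℝ (Fin d)) _) ∧
        ∫⁻ z, ENNReal.ofReal (w z.1) * edist z.1 z.2 ^ 2 ∂π'
          ≤ ENNReal.ofReal (ρ ^ 2) ^ k *
            ∫⁻ z, ENNReal.ofReal (w z.1) * edist z.1 z.2 ^ 2 ∂π := by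
    intro k π h1 h2
    induction k with
    | zero => exact ⟨π, by rw [h1, bind_kernel_pow_zero], by rw [h2, bind_kernel_pow_zero], by simp⟩
    | succ k ih =>
      obtain ⟨π₁, h11, h12, h13⟩ := ih
      have : IsProbabilityMeasure π₁ := ⟨by rw [← Measure.fst_univ, h11, measure_univ]⟩
      obtain ⟨π₂, h21, h22, h23⟩ := exists_synchronous_coupling hb δ T π₁
      refine ⟨π₂, by rw [h21, h11, bind_kernel_pow_succ],
        by rw [h22, h12, bind_kernel_pow_succ], ?_⟩
      rw [h23 _ hW, pow_succ', mul_assoc]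
      refine le_trans ?_ (mul_le_mul_right h13 _)
      rw [← lintegral_const_mul _ (by fun_prop)]
      refine lintegral_mono fun z => ?_
      rw [← ofReal_integral_eq_lintegral_ofReal (hwi _)
        (ae_of_all _ fun y => zero_le_one.trans (hw1 y)), hsq, hsq,
        ← ENNReal.ofReal_mul (integral_nonneg fun y => zero_le_one.trans (hw1 y)),
        ← ENNReal.ofReal_mul (zero_le_one.trans (hw1 _)), ← ENNReal.ofReal_mul (by positivity)]
      exact ENNReal.ofReal_le_ofReal (hc z.1 z.2)
  have ha0 : ENNReal.ofReal (M * ρ ^ k) ≠ 0 := by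
    simp only [ne_eq, ENNReal.ofReal_eq_zero, not_le]; positivity
  rw [← ENNReal.div_le_iff' ha0 ENNReal.ofReal_ne_top]
  -- Near-optimal couplings suffice, and an infinite distance leaves nothing to prove.
  refine le_of_forall_gt_imp_ge_of_dense fun r hr => ?_
  rw [ENNReal.div_le_iff' ha0 ENNReal.ofReal_ne_top]
  obtain ⟨π, h1, h2, h3⟩ := exists_coupling_of_wasserstein2_lt hr
  obtain ⟨π', h1', h2', h3'⟩ := hstep k π h1 h2
  refine wasserstein2_le_of_coupling π' h1' h2' ?_
  calc ∫⁻ z, edist z.1 z.2 ^ 2 ∂π' ≤ ∫⁻ z, ENNReal.ofReal (w z.1) * edist z.1 z.2 ^ 2 ∂π' := by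
        refine lintegral_mono fun z => le_mul_of_one_le_left' ?_
        rw [← ENNReal.ofReal_one]
        exact ENNReal.ofReal_le_ofReal (hw1 _)
    _ ≤ ENNReal.ofReal (ρ ^ 2) ^ k * ∫⁻ z, ENNReal.ofReal (w z.1) * edist z.1 z.2 ^ 2 ∂π := h3'
    _ ≤ ENNReal.ofReal (ρ ^ 2) ^ k * ∫⁻ z, ENNReal.ofReal (M ^ 2) * edist z.1 z.2 ^ 2 ∂π := by
        gcongr
        exact hwM _
    _ ≤ ENNReal.ofReal (ρ ^ 2) ^ k * (ENNReal.ofReal (M ^ 2) * r ^ 2) := by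
        rw [lintegral_const_mul _ (by fun_prop)]
        gcongr
    _ = (ENNReal.ofReal (M * ρ ^ k) * r) ^ 2 := by
        rw [mul_pow, ← ENNReal.ofReal_pow (by positivity), ← ENNReal.ofReal_pow (by positivity),
          ← mul_assoc, ← ENNReal.ofReal_mul (by positivity)]
        congr 2
        ring

end Coupling

/-! ### Existence of a Wasserstein contraction at high temperature -/

section Contraction

variable {d : ℕ} {b : EuclideanSpace ℝ (Fin d) → EuclideanSpace ℝ (Fin d)}

theorem norm_sq_euler_step_sub_le {Lb δ a : ℝ} (hδ : 0 ≤ δ) {x y : EuclideanSpace ℝ (Fin d)}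
    (hLip : ‖b x - b y‖ ≤ Lb * ‖x - y‖) (hin : inner ℝ (x - y) (b x - b y) ≤ a * ‖x - y‖ ^ 2) :
    ‖x + δ • b x - (y + δ • b y)‖ ^ 2 ≤ (1 + 2 * a * δ + Lb ^ 2 * δ ^ 2) * ‖x - y‖ ^ 2 := by
  have e : x + δ • b x - (y + δ • b y) = (x - y) + δ • (b x - b y) := by
    rw [smul_sub]; abel
  rw [e, norm_add_sq_real, inner_smul_right, norm_smul, Real.norm_of_nonneg hδ, mul_pow]
  have h1 : ‖b x - b y‖ ^ 2 ≤ (Lb * ‖x - y‖) ^ 2 := pow_le_pow_left₀ (norm_nonneg _) hLip 2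
  have h2 := mul_le_mul_of_nonneg_left hin hδ
  have h3 := mul_le_mul_of_nonneg_left h1 (sq_nonneg δ)
  nlinarith

/-- The occupation time of a measurable set up to time `n`, as a function of the starting point,
and its one-step drift. -/
theorem integral_sum_integral_kernel_pow {α : Type*} [MeasurableSpace α] (Q : Kernel α α)
    [IsMarkovKernel Q] {f : α → ℝ} (hf : Measurable f) {B : ℝ} (hB : ∀ x, |f x| ≤ B) (n : ℕ)
    (x : α) :
    ∫ z, ∑ k ∈ Finset.range n, ∫ y, f y ∂(Q ^ k) z ∂(Q x)
      = ∑ k ∈ Finset.range n, ∫ y, f y ∂(Q ^ k) x - f x + ∫ y, f y ∂(Q ^ n) x := by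
  rw [integral_finsetSum _ fun k _ => integrable_of_abs_le
    (StronglyMeasurable.integral_kernel hf.stronglyMeasurable).measurable
    fun z => abs_integral_le_of_abs_le hB]
  simp_rw [← integral_kernel_pow_succ Q _ x hf hB]
  have h := Finset.sum_range_succ' (fun k => ∫ y, f y ∂(Q ^ k) x) n
  rw [Finset.sum_range_succ, kernel_pow_zero_apply, integral_dirac' _ _ hf.stronglyMeasurable] at h
  linarith

/-- As `w ≤ 2`, a fall of `4(K + c)δ` is a relative fall of at least `(2K + 2c)δ`, which beats the
expansion `1 + (2K + c)δ` with `cδ` to spare. -/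
theorem mul_one_add_le_of_drift_inside {δ c K l w I : ℝ} (hδ : 0 < δ) (hc : 0 < c) (hK : 0 < K)
    (hl : l ≤ c / 2 * δ) (hI0 : 0 ≤ I) (hw1 : 1 ≤ w) (hw2 : w ≤ 2)
    (hI : I ≤ w - 8 * (K + c) * δ / 2) : I * (1 + 2 * K * δ + l) ≤ (1 - c * δ) * w := by
  have h1 : I ≤ w * (1 - (2 * K + 2 * c) * δ) := by
    linarith [mul_le_mul_of_nonneg_left hw2 (by positivity : 0 ≤ (2 * K + 2 * c) * δ)]
  have hcδ : 0 < c * δ := by positivity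
  calc _ ≤ I * (1 + (2 * K + c) * δ) := mul_le_mul_of_nonneg_left (by linarith) hI0
    _ ≤ (w * (1 - (2 * K + 2 * c) * δ)) * (1 + (2 * K + c) * δ) :=
        mul_le_mul_of_nonneg_right h1 (by positivity)
    _ = w * (1 - c * δ) - w * ((2 * K + 2 * c) * δ * ((2 * K + c) * δ)) := by ring
    _ ≤ (1 - c * δ) * w := by
        have : 0 ≤ w * ((2 * K + 2 * c) * δ * ((2 * K + c) * δ)) := by positivity
        linarith

/-- As `w ≥ 1`, the relative growth of the weight is at most `cδ/2`, against a contraction of at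
least `3cδ/2`. -/
theorem mul_one_add_le_of_drift_outside {δ c l w I : ℝ} (hδ : 0 < δ) (hc : 0 < c)
    (hl : l ≤ c / 2 * δ) (hβ : 0 ≤ 1 + 2 * (-c) * δ + l) (hw1 : 1 ≤ w)
    (hI : I ≤ w + c / 2 * δ) : I * (1 + 2 * (-c) * δ + l) ≤ (1 - c * δ) * w := by
  have h1 : I ≤ w * (1 + c / 2 * δ) := by
    linarith [mul_le_mul_of_nonneg_right hw1 (by positivity : 0 ≤ c / 2 * δ)]
  calc _ ≤ (w * (1 + c / 2 * δ)) * (1 + 2 * (-c) * δ + l) := mul_le_mul_of_nonneg_right h1 hβ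
    _ ≤ (w * (1 + c / 2 * δ)) * (1 - 3 / 2 * (c * δ)) :=
        mul_le_mul_of_nonneg_left (by linarith) (by positivity)
    _ = w * (1 - c * δ) - w * (3 / 4 * (c * δ) ^ 2) := by ring
    _ ≤ (1 - c * δ) * w := by
        have : 0 ≤ w * (3 / 4 * (c * δ) ^ 2) := by positivity
        linarith

set_option maxHeartbeats 400000 in
theorem exists_eulerW2Contraction (hd : 1 ≤ d) {Lb R c K : ℝ} (hLb : 0 < Lb) (hR : 0 < R)
    (hc : 0 < c) (hK : 0 < K)
    (hLip : ∀ x y, ‖b x - b y‖ ≤ Lb * ‖x - y‖)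
    (hout : ∀ x y, R ≤ ‖x‖ ∨ R ≤ ‖y‖ → inner ℝ (x - y) (b x - b y) ≤ -c * ‖x - y‖ ^ 2)
    (hin : ∀ x y, ‖x‖ < R → ‖y‖ < R → inner ℝ (x - y) (b x - b y) ≤ K * ‖x - y‖ ^ 2) :
    ∃ h δ₀ T₀ M : ℝ, EulerW2Contraction b h δ₀ T₀ M := by
  have hb : Measurable b := (LipschitzWith.of_dist_le_mul (K := Lb.toNNReal) fun x y => by
    rw [dist_eq_norm, dist_eq_norm, Real.coe_toNNReal _ hLb.le]
    exact hLip x y).continuous.measurable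
  -- `A` prices the time in the ball, `t` keeps the weight below `1 + 2tA = 2`, and `Aε = c/2`
  -- limits its growth outside the ball.
  set A := 8 * (K + c) with hA
  have hA0 : 0 < A := by positivity
  set t := 1 / (2 * A) with ht
  have ht0 : 0 < t := by positivity
  have hAt : A * (2 * t) = 1 := by rw [ht]; field_simp
  set ε := c / (2 * A) with hε
  have hε0 : 0 < ε := by positivity
  have hAε : A * ε = c / 2 := by rw [hε]; field_simp
  have hε2 : ε ≤ 1 / 2 := by
    rw [hε, div_le_div_iff₀ (by positivity) (by norm_num)]; linarith
  obtain ⟨T₀, hT₀, hball⟩ :=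
    exists_integral_indicator_ball_eulerKernel_pow_le hd hLip hLb.le hb hR ht0 hε0
  -- In order: the horizon satisfies `nδ ≤ 2t`; `Lb²δ²` is at most `cδ/2`; the ball estimate
  -- applies; contraction factors are nonnegative.
  set δ₀ := min (min t (c / (2 * Lb ^ 2))) (min (1 / 2 / (2 * Lb + 1)) (1 / (2 * c))) with hδ₀
  refine ⟨c / 2, δ₀, T₀, √2, by positivity, by positivity, hT₀, Real.one_le_sqrt.2 (by norm_num),
    fun δ T hδ hδδ₀ hT k _ μ ν hμ hν => ?_⟩
  have hδt : δ ≤ t := hδδ₀.trans ((min_le_left _ _).trans (min_le_left _ _))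
  have hδL : Lb ^ 2 * δ ≤ c / 2 := by
    have := hδδ₀.trans ((min_le_left _ _).trans (min_le_right _ _))
    rw [le_div_iff₀ (by positivity)] at this
    linarith
  have hδL' : δ * (2 * Lb + 1) ≤ 1 / 2 := by
    have := hδδ₀.trans ((min_le_right _ _).trans (min_le_left _ _))
    rwa [le_div_iff₀ (by positivity)] at this
  have hδc : 2 * c * δ ≤ 1 := by
    have := hδδ₀.trans ((min_le_right _ _).trans (min_le_right _ _))
    rw [le_div_iff₀ (by positivity)] at this
    linarith
  have := isMarkovKernel_eulerKernel hb δ T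
  set Q := eulerKernel b δ T with hQ
  set n := ⌈t / δ⌉₊ with hn
  have hn1 : t ≤ n * δ := (div_le_iff₀ hδ).1 (Nat.le_ceil _)
  have hn2 : n * δ ≤ 2 * t := by
    have := (Nat.ceil_lt_add_one (div_nonneg ht0.le hδ.le)).le
    rw [← hn, ← sub_le_iff_le_add, le_div_iff₀ hδ] at this
    linarith
  set f : EuclideanSpace ℝ (Fin d) → ℝ := (Metric.ball 0 R).indicator (fun _ => (1 : ℝ)) with hf
  have hfm : Measurable f := measurable_const.indicator measurableSet_ball
  have hf0 : ∀ x, 0 ≤ f x := fun x => Set.indicator_nonneg (fun _ _ => zero_le_one) x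
  have hf1 : ∀ x, |f x| ≤ 1 := fun x => by
    rw [abs_of_nonneg (hf0 x)]
    exact Set.indicator_apply_le' (fun _ => le_rfl) fun _ => zero_le_one
  set S : EuclideanSpace ℝ (Fin d) → ℝ :=
    fun x => ∑ k ∈ Finset.range n, ∫ y, f y ∂(Q ^ k) x with hS
  have hSm : Measurable S := Finset.measurable_fun_sum _ fun k _ =>
    (StronglyMeasurable.integral_kernel hfm.stronglyMeasurable).measurable
  have hS0 : ∀ x, 0 ≤ S x := fun x => Finset.sum_nonneg fun k _ => integral_nonneg hf0
  have hSn : ∀ x, S x ≤ n := fun x => by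
    refine (Finset.sum_le_card_nsmul _ _ 1 fun k _ => ?_).trans (by simp)
    exact (le_abs_self _).trans (abs_integral_le_of_abs_le hf1)
  set w : EuclideanSpace ℝ (Fin d) → ℝ := fun x => 1 + A * δ * S x with hw
  have hw1 : ∀ x, 1 ≤ w x := fun x => by
    have := hS0 x
    have : 0 ≤ A * δ * S x := by positivity
    simp only [hw]; linarith
  have hw2 : ∀ x, w x ≤ 2 := fun x => by
    have : A * δ * S x ≤ A * (2 * t) := by
      calc A * δ * S x ≤ A * δ * n := by gcongr; exact hSn x
        _ = A * (n * δ) := by ring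
        _ ≤ _ := by gcongr
    simp only [hw]; linarith
  -- Shifting the occupation time by one step loses the visit at time `0` and gains one at time `n`,
  -- of probability at most `ε`.
  have hQw : ∀ x, ∫ z, w z ∂(Q x) ≤ w x - A * δ * f x + A * δ * ε := fun x => by
    have hSi : Integrable S (Q x) := integrable_of_abs_le hSm (B := n) fun y => by
      rw [abs_of_nonneg (hS0 y)]; exact hSn y
    have hp := hball δ T hδ hδL' hT n hn1 hn2 x
    simp only [hw]
    rw [integral_add (integrable_const _) (hSi.const_mul _), integral_const_mul,
      integral_sum_integral_kernel_pow Q hfm hf1]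
    simp only [integral_const, probReal_univ, smul_eq_mul, mul_one]
    have := mul_le_mul_of_nonneg_left hp (by positivity : 0 ≤ A * δ)
    simp only [hS]
    linarith
  refine wasserstein2_bind_eulerKernel_pow_le hb (w := w) (by fun_prop) (by positivity)
    (by linarith) hw1 (fun x => by rw [Real.sq_sqrt (by norm_num)]; exact hw2 x) ?_ k μ ν
  intro x y
  have hwx1 := hw1 x
  have hwx2 := hw2 x
  have hρ : 1 - c * δ ≤ (1 - c / 2 * δ) ^ 2 := by linarith [sq_nonneg (c / 2 * δ)]
  have hLδ : Lb ^ 2 * δ ^ 2 ≤ c / 2 * δ := by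
    rw [sq δ, ← mul_assoc]; exact mul_le_mul_of_nonneg_right hδL hδ.le
  have hint0 : 0 ≤ ∫ z, w z ∂(Q x) := integral_nonneg fun z => zero_le_one.trans (hw1 z)
  have hAδε : A * δ * ε = c / 2 * δ := by rw [← hAε]; ring
  suffices hkey : ∃ β, 0 ≤ β ∧ ‖x + δ • b x - (y + δ • b y)‖ ^ 2 ≤ β * ‖x - y‖ ^ 2 ∧
      (∫ z, w z ∂(Q x)) * β ≤ (1 - c * δ) * w x by
    obtain ⟨β, hβ0, hβ1, hβ2⟩ := hkey
    calc _ ≤ (∫ z, w z ∂(Q x)) * (β * ‖x - y‖ ^ 2) := by gcongr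
      _ = (∫ z, w z ∂(Q x)) * β * ‖x - y‖ ^ 2 := by ring
      _ ≤ (1 - c * δ) * w x * ‖x - y‖ ^ 2 := by gcongr
      _ ≤ (1 - c / 2 * δ) ^ 2 * w x * ‖x - y‖ ^ 2 := by gcongr
      _ = _ := by ring
  have hQx := hQw x
  -- Only the position of `x` matters: outside the ball `hout` applies for every `y`, and inside the
  -- expansion rate is at most `K` in all cases.
  by_cases hx : ‖x‖ < R
  · have hfx : f x = 1 := Set.indicator_of_mem (mem_ball_zero_iff.2 hx) _
    rw [hfx, mul_one, hA] at hQx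
    have hQx' : A * δ * ε ≤ A * δ / 2 := by
      linarith [mul_le_mul_of_nonneg_left hε2 (by positivity : 0 ≤ A * δ)]
    rw [hA] at hQx'
    have hinn : inner ℝ (x - y) (b x - b y) ≤ K * ‖x - y‖ ^ 2 := by
      by_cases hy : ‖y‖ < R
      · exact hin x y hx hy
      · refine (hout x y (Or.inr (not_lt.1 hy))).trans ?_
        gcongr
        linarith
    refine ⟨1 + 2 * K * δ + Lb ^ 2 * δ ^ 2, by positivity,
      norm_sq_euler_step_sub_le hδ.le (hLip x y) hinn, ?_⟩
    exact mul_one_add_le_of_drift_inside hδ hc hK hLδ hint0 hwx1 hwx2 (by linarith)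
  · have hfx : f x = 0 := Set.indicator_of_notMem (by simpa using hx) _
    rw [hfx, mul_zero, sub_zero] at hQx
    have hβ0 : 0 ≤ 1 + 2 * (-c) * δ + Lb ^ 2 * δ ^ 2 := by
      linarith [mul_nonneg (sq_nonneg Lb) (sq_nonneg δ)]
    refine ⟨1 + 2 * (-c) * δ + Lb ^ 2 * δ ^ 2, hβ0,
      norm_sq_euler_step_sub_le hδ.le (hLip x y) (hout x y (Or.inl (not_lt.1 hx))), ?_⟩
    exact mul_one_add_le_of_drift_outside hδ hc hLδ hβ0 hwx1 (by linarith)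

end Contraction

/-! ### Consequences of the contraction -/

section Consequences

variable {d : ℕ} {b : EuclideanSpace ℝ (Fin d) → EuclideanSpace ℝ (Fin d)} {h δ₀ T₀ M δ T : ℝ}

theorem EulerW2Contraction.wasserstein2_eulerKernel_pow_le (hW : EulerW2Contraction b h δ₀ T₀ M)
    (hδ : 0 < δ) (hδ₀ : δ ≤ δ₀) (hT : T₀ ≤ T) {k : ℕ} (hk : 1 ≤ k)
    (x y : EuclideanSpace ℝ (Fin d)) :
    wasserstein2 ((eulerKernel b δ T ^ k) x) ((eulerKernel b δ T ^ k) y)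
      ≤ ENNReal.ofReal (M * (1 - h * δ) ^ k) * ENNReal.ofReal ‖x - y‖ := by
  have := hW.2.2.2.2 δ T hδ hδ₀ hT k hk (Measure.dirac x) (Measure.dirac y) inferInstance
    inferInstance
  rw [Measure.dirac_bind (Kernel.measurable _), Measure.dirac_bind (Kernel.measurable _)] at this
  exact this.trans (mul_le_mul_right (wasserstein2_dirac_le x y) _)

theorem integral_inner_eulerKernel (hb : Measurable b) (δ T : ℝ)
    (x v : EuclideanSpace ℝ (Fin d)) :
    Integrable (fun y => inner ℝ v y) (eulerKernel b δ T x) ∧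
      ∫ y, inner ℝ v y ∂(eulerKernel b δ T x) = inner ℝ v (x + δ • b x) := by
  have hid : Integrable (fun z : EuclideanSpace ℝ (Fin d) => z) (stdGaussian _) :=
    (IsGaussian.memLp_id (stdGaussian (EuclideanSpace ℝ (Fin d))) 1 (by simp)).integrable le_rfl
  have hi := hid.const_inner (𝕜 := ℝ) v
  have h0 : ∫ z, inner ℝ v z ∂(stdGaussian (EuclideanSpace ℝ (Fin d))) = 0 := by
    rw [integral_inner hid, integral_id_stdGaussian, inner_zero_right]
  constructor
  · rw [eulerKernel_apply hb, integrable_map_measure (by fun_prop) (by fun_prop)]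
    refine ((integrable_const (inner ℝ v (x + δ • b x))).add
      (hi.const_mul √(2 * T * δ))).congr (ae_of_all _ fun z => ?_)
    simp [inner_add_right, inner_smul_right]
  · rw [integral_eulerKernel hb x (by fun_prop)]
    simp_rw [inner_add_right _ (x + δ • b x), inner_smul_right]
    rw [integral_add (integrable_const _) (hi.const_mul _), integral_const_mul, h0]
    simp

/-- At distance zero the two laws have the same mean, read off by testing against the Lipschitz
functions `⟨v, ·⟩`. -/
theorem euler_step_eq_of_wasserstein2_eq_zero (hb : Measurable b) {x y : EuclideanSpace ℝ (Fin d)}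
    (hxy : wasserstein2 (eulerKernel b δ T x) (eulerKernel b δ T y) = 0) :
    x + δ • b x = y + δ • b y := by
  have := isMarkovKernel_eulerKernel hb δ T
  refine ext_inner_left ℝ fun v => ?_
  have hL : LipschitzWith ‖v‖₊ fun z : EuclideanSpace ℝ (Fin d) => (inner ℝ v z : ℝ) :=
    LipschitzWith.of_dist_le_mul fun z w => by
      rw [Real.dist_eq, ← inner_sub_right, dist_eq_norm, coe_nnnorm]
      exact abs_real_inner_le_norm _ _
  obtain ⟨hix, hx⟩ := integral_inner_eulerKernel hb δ T x v
  obtain ⟨hiy, hy⟩ := integral_inner_eulerKernel hb δ T y v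
  have := abs_integral_sub_le_of_lipschitz hL hix hiy le_rfl (by simp [hxy])
  rw [hx, hy, mul_zero, abs_nonpos_iff, sub_eq_zero] at this
  exact this.symm

/-- A contraction rate valid for all step sizes up to `δ₀` is nondegenerate for `δ < δ₀`. -/
theorem EulerW2Contraction.mul_lt_one (hW : EulerW2Contraction b h δ₀ T₀ M) (hd : 1 ≤ d)
    (hb : Measurable b) (hδ : 0 < δ) (hδ₀ : δ < δ₀) : h * δ < 1 := by
  by_contra hcon
  rw [not_lt] at hcon
  obtain ⟨hh, hδ₀', -, hM, -⟩ := id hW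
  have hstep : ∀ s, δ ≤ s → s ≤ δ₀ → ∀ x y, x + s • b x = y + s • b y := by
    intro s hs hs₀ x y
    have hle := hW.wasserstein2_eulerKernel_pow_le (hδ.trans_le hs) hs₀ le_rfl le_rfl x y
    -- At `k = 1` a nonpositive factor is truncated to `0` by `ENNReal.ofReal`, so the distance
    -- vanishes.
    have hneg : M * (1 - h * s) ^ 1 ≤ 0 := by
      rw [pow_one]
      refine mul_nonpos_of_nonneg_of_nonpos (by linarith) ?_
      linarith [mul_le_mul_of_nonneg_left hs hh.le]
    rw [ENNReal.ofReal_of_nonpos hneg, zero_mul, pow_one] at hle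
    exact euler_step_eq_of_wasserstein2_eq_zero hb (nonpos_iff_eq_zero.1 hle)
  have : Nonempty (Fin d) := ⟨⟨0, hd⟩⟩
  obtain ⟨x, y, hxy⟩ := exists_pair_ne (EuclideanSpace ℝ (Fin d))
  have h1 : x - y = -(δ • (b x - b y)) := by
    rw [smul_sub, neg_sub, sub_eq_sub_iff_add_eq_add]
    exact (hstep δ le_rfl hδ₀.le x y).trans (add_comm _ _)
  have h2 : x - y = -(δ₀ • (b x - b y)) := by
    rw [smul_sub, neg_sub, sub_eq_sub_iff_add_eq_add]
    exact (hstep δ₀ hδ₀.le le_rfl x y).trans (add_comm _ _)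
  -- Two distinct step sizes force `b x = b y`, then `x = y`; this needs `δ < δ₀` strictly.
  have h3 : (δ₀ - δ) • (b x - b y) = 0 := by
    rw [sub_smul, sub_eq_zero, ← neg_inj, ← h1, ← h2]
  rcases smul_eq_zero.1 h3 with h4 | h4
  · linarith
  · rw [h4, smul_zero, neg_zero, sub_eq_zero] at h1
    exact hxy h1

/-- The case `k = 0`, absent from the hypothesis, holds because `M ≥ 1`. -/
theorem EulerW2Contraction.diracContraction (hW : EulerW2Contraction b h δ₀ T₀ M)
    (hδ : 0 < δ) (hδ₀ : δ ≤ δ₀) (hT : T₀ ≤ T) (hhδ : h * δ < 1) :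
    DiracContraction (eulerKernel b δ T) M (1 - h * δ) := by
  intro k x y
  have hM := hW.2.2.2.1
  have hρ : 0 ≤ 1 - h * δ := by linarith
  rw [norm_sub_rev, ENNReal.ofReal_mul (mul_nonneg (by linarith) (pow_nonneg hρ k))]
  rcases Nat.eq_zero_or_pos k with rfl | hk
  · rw [kernel_pow_zero_apply, kernel_pow_zero_apply]
    refine (wasserstein2_dirac_le x y).trans (le_mul_of_one_le_left' ?_)
    rw [pow_zero, mul_one, ← ENNReal.ofReal_one]
    exact ENNReal.ofReal_le_ofReal hM
  · exact hW.wasserstein2_eulerKernel_pow_le hδ hδ₀ hT hk x y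

/-- For smooth compactly supported `f`, the three integrands `f`, `f²` and `|∇f|²` are bounded and
continuous, so the inequality passes to the weak limit. -/
theorem poincareInequality_of_tendsto {μ : ℕ → Measure (EuclideanSpace ℝ (Fin d))}
    {π : Measure (EuclideanSpace ℝ (Fin d))} [∀ k, IsProbabilityMeasure (μ k)]
    [IsProbabilityMeasure π]
    (hlim : ∀ (f : EuclideanSpace ℝ (Fin d) → ℝ) (B : ℝ), Continuous f → (∀ y, |f y| ≤ B) →
      Filter.Tendsto (fun k => ∫ y, f y ∂(μ k)) Filter.atTop (nhds (∫ y, f y ∂π)))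
    {C : ℝ} (hC : 0 < C) (hμ : ∀ k, PoincareInequality (μ k) C)
    (hvar : ∀ f : EuclideanSpace ℝ (Fin d) → ℝ, ContDiff ℝ ∞ f → HasCompactSupport f → ∀ k,
      ∫ x, f x ^ 2 ∂(μ k) - (∫ x, f x ∂(μ k)) ^ 2 ≤ C * ∫ x, ‖fderiv ℝ f x‖ ^ 2 ∂(μ k))
    {B : ℝ} (hB : ∀ k, ∫ x, ‖x‖ ∂(μ k) ≤ B) : PoincareInequality π C := by
  refine poincareInequality_of_hasCompactSupport hC
    (integrable_one_add_norm_pow_of_tendsto hlim hC.le hμ hB) fun f hf hfc => ?_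
  obtain ⟨L, hL⟩ := hf.lipschitzWith_of_hasCompactSupport hfc (by simp)
  obtain ⟨D, hD⟩ := hf.continuous.bounded_above_of_compact_support hfc
  have h1 := hlim f D hf.continuous hD
  have h2 := hlim (fun x => f x ^ 2) (D ^ 2) (hf.continuous.pow 2) fun y => by
    rw [abs_pow]; exact pow_le_pow_left₀ (abs_nonneg _) (hD y) 2
  have h3 := hlim (fun x => ‖fderiv ℝ f x‖ ^ 2) ((L : ℝ) ^ 2) ((continuous_norm_fderiv hf).pow 2)
    fun y => by
      rw [abs_of_nonneg (by positivity)]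
      exact pow_le_pow_left₀ (norm_nonneg _) (norm_fderiv_le_of_lipschitz ℝ hL) 2
  exact le_of_tendsto_of_tendsto' (h2.sub (h1.pow 2)) (h3.const_mul C) (hvar f hf hfc)

end Consequences

/-! ### The main theorem -/

theorem mainTheorem6 (d : ℕ) (hd : 1 ≤ d)
    (b : EuclideanSpace ℝ (Fin d) → EuclideanSpace ℝ (Fin d))
    (Lb R c K : ℝ) (hLb : 0 < Lb) (hR : 0 < R) (hc : 0 < c) (hK : 0 < K)
    (hLip : ∀ x y, ‖b x - b y‖ ≤ Lb * ‖x - y‖)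
    (hout : ∀ x y, R ≤ ‖x‖ ∨ R ≤ ‖y‖ → inner ℝ (x - y) (b x - b y) ≤ -c * ‖x - y‖ ^ 2)
    (hin : ∀ x y, ‖x‖ < R → ‖y‖ < R → inner ℝ (x - y) (b x - b y) ≤ K * ‖x - y‖ ^ 2) :
    (∃ h δ₀ T₀ M : ℝ, EulerW2Contraction b h δ₀ T₀ M) ∧
    ∀ h δ₀ T₀ M : ℝ, EulerW2Contraction b h δ₀ T₀ M →
      ∀ δ T : ℝ, 0 < δ → δ < δ₀ → T₀ ≤ T →
        (∀ k : ℕ, 1 ≤ k →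
          LocalPoincareInequality (eulerKernel b δ T ^ k)
            (2 * T * M ^ 2 / (2 * h - h ^ 2 * δ))) ∧
        (∃ π : Measure (EuclideanSpace ℝ (Fin d)),
          IsProbabilityMeasure π ∧ (eulerKernel b δ T).Invariant π ∧
          (∀ π' : Measure (EuclideanSpace ℝ (Fin d)),
            IsProbabilityMeasure π' → (eulerKernel b δ T).Invariant π' → π' = π) ∧
          PoincareInequality π (2 * T * M ^ 2 / (2 * h - h ^ 2 * δ))) ∧
        0 < 2 * T * M ^ 2 / (2 * h - h ^ 2 * δ) ∧
        2 * T * M ^ 2 / (2 * h - h ^ 2 * δ) ≤ 2 * T * M ^ 2 / h := by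
  refine ⟨exists_eulerW2Contraction hd hLb hR hc hK hLip hout hin, ?_⟩
  intro h δ₀ T₀ M hW δ T hδ hδ₀ hT
  have hb : Measurable b := (LipschitzWith.of_dist_le_mul (K := Lb.toNNReal) fun x y => by
    rw [dist_eq_norm, dist_eq_norm, Real.coe_toNNReal _ hLb.le]
    exact hLip x y).continuous.measurable
  have := isMarkovKernel_eulerKernel hb δ T
  obtain ⟨hh, -, hT₀, hM, -⟩ := id hW
  have hT0 : 0 < T := hT₀.trans_le hT
  have hM0 : 0 < M := by linarith
  have hhδ := hW.mul_lt_one hd hb hδ hδ₀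
  have hhδ0 : 0 < h * δ := by positivity
  have hD := hW.diracContraction hδ hδ₀.le hT hhδ
  -- From `hδ < 1`; this yields both the positivity of the constant and its uniform bound.
  have hden : h ≤ 2 * h - h ^ 2 * δ := by
    linarith [mul_lt_mul_of_pos_left hhδ hh, (by ring : h ^ 2 * δ = h * (h * δ))]
  have hC : 0 < 2 * T * M ^ 2 / (2 * h - h ^ 2 * δ) :=
    div_pos (by positivity) (hh.trans_le hden)
  have hvar : ∀ k x, ∀ f : EuclideanSpace ℝ (Fin d) → ℝ, ContDiff ℝ ∞ f → HasCompactSupport f →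
      ∫ y, f y ^ 2 ∂((eulerKernel b δ T ^ k) x) - (∫ y, f y ∂((eulerKernel b δ T ^ k) x)) ^ 2
        ≤ 2 * T * M ^ 2 / (2 * h - h ^ 2 * δ) *
          ∫ y, ‖fderiv ℝ f y‖ ^ 2 ∂((eulerKernel b δ T ^ k) x) := fun k x f hf hfc =>
    hD.variance_eulerKernel_pow_le hb hδ hT0.le hM0.le hh hhδ hf hfc k x
  have hmom : ∀ (k : ℕ) x (m : ℕ), Integrable (fun y => (1 + ‖y‖) ^ m)
      ((eulerKernel b δ T ^ k) x) := fun k x m =>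
    integrable_one_add_norm_pow_eulerKernel_pow hLb.le hLip hb hδ.le m k x
  have hloc : ∀ k : ℕ, LocalPoincareInequality (eulerKernel b δ T ^ k)
      (2 * T * M ^ 2 / (2 * h - h ^ 2 * δ)) := fun k x =>
    poincareInequality_of_hasCompactSupport hC (hmom k x) (hvar k x)
  have hnorm : ∀ (k : ℕ) x, Integrable (fun y => ‖y‖) ((eulerKernel b δ T ^ k) x) := fun k x => by
    refine (hmom k x 1).mono' (by fun_prop) (ae_of_all _ fun y => ?_)
    rw [norm_norm, pow_one]
    linarith
  refine ⟨fun k _ => hloc k, ?_, hC, ?_⟩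
  · have hρ0 : 0 ≤ 1 - h * δ := by linarith
    have hρ1 : 1 - h * δ < 1 := by linarith
    obtain ⟨π, hπ, hlim⟩ := hD.exists_tendsto hM0.le hρ0 hρ1 hnorm
    obtain ⟨B, hB⟩ := hD.exists_integral_norm_le hM0.le hρ0 hρ1 hnorm
    refine ⟨π, hπ, hD.invariant_of_tendsto hM0.le hρ0 hlim,
      fun π' _ hinv => invariant_eq_of_tendsto hlim hinv, ?_⟩
    exact poincareInequality_of_tendsto (hlim 0) hC (fun k => hloc k 0)
      (fun f hf hfc k => hvar k 0 f hf hfc) hB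
  · exact div_le_div_of_nonneg_left (by positivity) hh hden
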